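/- For $n\ge 1$ let $\mathfrak{nil}_n$ be the Lie ring of strictly upper-triangular integral $n\times n$ matrices, with basis the matrix units $e_{ab}$ $(1\le a<b\le n)$, and let $C_*=\Lambda^*\mathfrak{nil}_n$ be its Chevalley--Eilenberg complex, with boundary $$\partial(x_1\wedge\dots\wedge x_k)=\sum_{i<j}(-1)^{i+j}[x_i,x_j]\wedge x_1\wedge\dots\widehat{x_i}\dots\widehat{x_j}\dots\wedge x_k,$$ so that $H_*(\mathfrak{nil}_n;\mathbb Z)=H_*(C_*)$. For $w\in\mathbb Z^n$ let $[[w]]=[[w_1,\dots,w_n]]\subseteq C_*$ be the subcomplex spanned by the wedges $e_{a_1b_1}\wedge\dots\wedge e_{a_kb_k}$ such that for all $i\in\{1,\dots,n\}$ $$w_i=i-|\{m:\,b_m=i\}|+|\{m:\,a_m=i\}|.$$ Let $q=p^m$ ($p$ prime, $m\ge 1$) be a prime power with $q\le n-2$, and let $$w=(2,3,\dots,q+1,\,2,\,q+1,\,q+3,\dots,n)$$ (the last block is empty if $q=n-2$). Then $[[w]]$ is a direct summand of the chain complex $C_*$, $$H_k[[w]]\cong\begin{cases}\mathbb Z/q,&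 k=q,\\ 0,& k\ne q.\end{cases}$$ Consequently, $H_q(\mathfrak{nil}_n;\mathbb Z)$ has a direct summand isomorphic to $\mathbb Z/q$; in particular $H_*(\mathfrak{nil}_n;\mathbb Z)$ contains $\mathbb Z_q$-torsion for every prime power $q\le n-2$. -/

import Mathlib

open CategoryTheory

/-! ## The Chevalley–Eilenberg complex of a Lie algebra (trivial coefficients) -/

universe u v

namespace LieHomology

section General

/-- Recursion step for `adAction`: `(y, (a, b)) ↦ ⁅x, y⁆ ∧ a + y ∧ b`. -/
noncomputable def adStep (R : Type*) {L : Type*} [CommRing R] [LieRing L] [LieAlgebra R L] (x : L) :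
    L →ₗ[R] ExteriorAlgebra R L × ExteriorAlgebra R L →ₗ[R] ExteriorAlgebra R L :=
  LinearMap.mk₂ R (fun y p => ExteriorAlgebra.ι R ⁅x, y⁆ * p.1 + ExteriorAlgebra.ι R y * p.2)
    (fun y z p => by simp only [lie_add, map_add, add_mul]; abel)
    (fun c y p => by simp only [lie_smul, map_smul, smul_mul_assoc, smul_add])
    (fun y p p' => by simp only [Prod.fst_add, Prod.snd_add, mul_add]; abel)
    (fun c y p => by simp only [Prod.smul_fst, Prod.smul_snd, mul_smul_comm, smul_add])

variable {R L : Type*} [CommRing R] [LieRing L] [LieAlgebra R L]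

theorem adStep_adStep (x y : L) (a c : ExteriorAlgebra R L) :
    adStep R x y (ExteriorAlgebra.ι R y * a, adStep R x y (a, c))
      = (0 : QuadraticForm R L) y • c := by
  have h1 : ExteriorAlgebra.ι R ⁅x, y⁆ * (ExteriorAlgebra.ι R y * a)
      + ExteriorAlgebra.ι R y * (ExteriorAlgebra.ι R ⁅x, y⁆ * a) = 0 := by
    rw [← mul_assoc, ← mul_assoc, ← add_mul, ExteriorAlgebra.ι_add_mul_swap, zero_mul]
  have h2 : ExteriorAlgebra.ι R y * (ExteriorAlgebra.ι R y * c) = 0 := by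
    rw [← mul_assoc, ExteriorAlgebra.ι_sq_zero, zero_mul]
  change ExteriorAlgebra.ι R ⁅x, y⁆ * (ExteriorAlgebra.ι R y * a)
    + ExteriorAlgebra.ι R y * (ExteriorAlgebra.ι R ⁅x, y⁆ * a + ExteriorAlgebra.ι R y * c) = _
  rw [mul_add, ← add_assoc, h1, h2]
  simp

/-- The derivation of the exterior algebra of `L` that extends `⁅x, ·⁆`, for one `x`;
see `adAction_one`, `adAction_ι_mul`. -/
noncomputable def adActionAux (R : Type*) {L : Type*} [CommRing R] [LieRing L] [LieAlgebra R L]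
    (x : L) : ExteriorAlgebra R L →ₗ[R] ExteriorAlgebra R L :=
  CliffordAlgebra.foldr' (0 : QuadraticForm R L) (adStep R x) (adStep_adStep x) 0

theorem adActionAux_algebraMap (x : L) (r : R) :
    adActionAux R x (algebraMap R (ExteriorAlgebra R L) r) = 0 :=
  (CliffordAlgebra.foldr'_algebraMap (0 : QuadraticForm R L) (adStep R x)
    (adStep_adStep x) 0 r).trans (smul_zero r)

theorem adActionAux_ι_mul (x y : L) (a : ExteriorAlgebra R L) :
    adActionAux R x (ExteriorAlgebra.ι R y * a)
      = ExteriorAlgebra.ι R ⁅x, y⁆ * a + ExteriorAlgebra.ι R y * adActionAux R x a :=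
  CliffordAlgebra.foldr'_ι_mul (0 : QuadraticForm R L) (adStep R x) (adStep_adStep x) 0 y a

/-- Left induction on the exterior algebra. -/
theorem wedge_induction {P : ExteriorAlgebra R L → Prop}
    (h0 : ∀ r : R, P (algebraMap R _ r)) (hadd : ∀ a b, P a → P b → P (a + b))
    (hmul : ∀ (x : L) (a : ExteriorAlgebra R L), P a → P (ExteriorAlgebra.ι R x * a))
    (a : ExteriorAlgebra R L) : P a :=
  CliffordAlgebra.left_induction (Q := (0 : QuadraticForm R L)) h0 hadd
    (fun a x ha => hmul x a ha) a

/-- The adjoint action of `L` on its exterior algebra, by derivations. -/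
noncomputable def adAction (R : Type*) {L : Type*} [CommRing R] [LieRing L] [LieAlgebra R L] :
    L →ₗ[R] ExteriorAlgebra R L →ₗ[R] ExteriorAlgebra R L where
  toFun x := adActionAux R x
  map_add' x y := by
    refine LinearMap.ext fun a => ?_
    induction a using wedge_induction with
    | h0 r => simp [adActionAux_algebraMap]
    | hadd a b ha hb => rw [map_add, map_add, ha, hb]
    | hmul z a ha =>
      rw [LinearMap.add_apply] at ha ⊢
      simp only [adActionAux_ι_mul, ha, add_lie, map_add, add_mul, mul_add]
      abel
  map_smul' c x := by
    refine LinearMap.ext fun a => ?_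
    induction a using wedge_induction with
    | h0 r => simp [adActionAux_algebraMap]
    | hadd a b ha hb => rw [map_add, map_add, ha, hb]
    | hmul z a ha =>
      simp only [RingHom.id_apply, LinearMap.smul_apply] at ha ⊢
      simp only [adActionAux_ι_mul, ha, smul_lie, map_smul, smul_mul_assoc, mul_smul_comm, smul_add]

theorem adAction_algebraMap (x : L) (r : R) :
    adAction R x (algebraMap R (ExteriorAlgebra R L) r) = 0 :=
  adActionAux_algebraMap x r

theorem adAction_one (x : L) : adAction R x (1 : ExteriorAlgebra R L) = 0 := by
  simpa using adAction_algebraMap (R := R) x 1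

theorem adAction_ι_mul (x y : L) (a : ExteriorAlgebra R L) :
    adAction R x (ExteriorAlgebra.ι R y * a)
      = ExteriorAlgebra.ι R ⁅x, y⁆ * a + ExteriorAlgebra.ι R y * adAction R x a :=
  adActionAux_ι_mul x y a

theorem adAction_lie (x y : L) (a : ExteriorAlgebra R L) :
    adAction R ⁅x, y⁆ a = adAction R x (adAction R y a) - adAction R y (adAction R x a) := by
  induction a using wedge_induction with
  | h0 r => simp [adAction_algebraMap]
  | hadd a b ha hb => simp only [map_add, ha, hb]; abel
  | hmul z a ha =>
    simp only [adAction_ι_mul, map_add, ha, mul_sub, lie_lie, map_sub, sub_mul]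
    abel

/-- Recursion step for `boundary`: `(x, (a, b)) ↦ -(ad x (a) + x ∧ b)`. -/
noncomputable def boundaryStep (R L : Type*) [CommRing R] [LieRing L] [LieAlgebra R L] :
    L →ₗ[R] ExteriorAlgebra R L × ExteriorAlgebra R L →ₗ[R] ExteriorAlgebra R L :=
  LinearMap.mk₂ R (fun x p => -(adAction R x p.1 + ExteriorAlgebra.ι R x * p.2))
    (fun x y p => by simp only [map_add, LinearMap.add_apply, add_mul]; abel)
    (fun c x p => by
      simp only [map_smul, LinearMap.smul_apply, smul_mul_assoc, smul_add, smul_neg])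
    (fun x p p' => by simp only [Prod.fst_add, Prod.snd_add, map_add, mul_add]; abel)
    (fun c x p => by
      simp only [Prod.smul_fst, Prod.smul_snd, map_smul, mul_smul_comm, smul_add, smul_neg])

theorem boundaryStep_boundaryStep (x : L) (a c : ExteriorAlgebra R L) :
    boundaryStep R L x (ExteriorAlgebra.ι R x * a, boundaryStep R L x (a, c))
      = (0 : QuadraticForm R L) x • c := by
  have h2 : ExteriorAlgebra.ι R x * (ExteriorAlgebra.ι R x * c) = 0 := by
    rw [← mul_assoc, ExteriorAlgebra.ι_sq_zero, zero_mul]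
  change -(adAction R x (ExteriorAlgebra.ι R x * a)
    + ExteriorAlgebra.ι R x * -(adAction R x a + ExteriorAlgebra.ι R x * c)) = _
  rw [adAction_ι_mul, lie_self, map_zero, zero_mul, mul_neg, mul_add, h2]
  simp

/-- The Chevalley–Eilenberg boundary on the exterior algebra of `L`. It is defined by recursion,
`∂ 1 = 0` and `∂ (x ∧ a) = -(ad x (a) + x ∧ ∂ a)`; the usual closed formula
`∂ (x₁ ∧ ⋯ ∧ xₖ) = ∑_{i < j} (-1)^(i+j) ⁅xᵢ, xⱼ⁆ ∧ x₁ ∧ ⋯ x̂ᵢ ⋯ x̂ⱼ ⋯ ∧ xₖ`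
is proved below as `boundary_wedge`. -/
noncomputable def boundary (R L : Type*) [CommRing R] [LieRing L] [LieAlgebra R L] :
    ExteriorAlgebra R L →ₗ[R] ExteriorAlgebra R L :=
  CliffordAlgebra.foldr' (0 : QuadraticForm R L) (boundaryStep R L) boundaryStep_boundaryStep 0

theorem boundary_algebraMap (r : R) :
    boundary R L (algebraMap R (ExteriorAlgebra R L) r) = 0 :=
  (CliffordAlgebra.foldr'_algebraMap (0 : QuadraticForm R L) (boundaryStep R L)
    boundaryStep_boundaryStep 0 r).trans (smul_zero r)

theorem boundary_one : boundary R L 1 = 0 := by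
  simpa using boundary_algebraMap (R := R) (L := L) 1

theorem boundary_ι_mul (x : L) (a : ExteriorAlgebra R L) :
    boundary R L (ExteriorAlgebra.ι R x * a)
      = -(adAction R x a + ExteriorAlgebra.ι R x * boundary R L a) :=
  CliffordAlgebra.foldr'_ι_mul (0 : QuadraticForm R L) (boundaryStep R L)
    boundaryStep_boundaryStep 0 x a

theorem boundary_adAction (x : L) (a : ExteriorAlgebra R L) :
    boundary R L (adAction R x a) = adAction R x (boundary R L a) := by
  induction a using wedge_induction with
  | h0 r => simp [adAction_algebraMap, boundary_algebraMap]
  | hadd a b ha hb => simp only [map_add, ha, hb]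
  | hmul y a ha =>
    simp only [adAction_ι_mul, boundary_ι_mul, map_add, map_neg, ha, adAction_lie]
    abel

theorem boundary_boundary (a : ExteriorAlgebra R L) :
    boundary R L (boundary R L a) = 0 := by
  induction a using wedge_induction with
  | h0 r => simp [boundary_algebraMap]
  | hadd a b ha hb => simp only [map_add, ha, hb, add_zero]
  | hmul x a ha =>
    simp only [boundary_ι_mul, map_add, map_neg, boundary_adAction, ha]
    simp

/-- The ordered wedge of the entries of `x` whose position is neither `i` nor `j`. -/
noncomputable def wedgeOmit (R : Type*) {L : Type*} [CommRing R] [LieRing L] [LieAlgebra R L]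
    {k : ℕ} (x : Fin k → L) (i j : Fin k) : ExteriorAlgebra R L :=
  (((List.finRange k).filter (fun m => m ≠ i ∧ m ≠ j)).map
    (fun m => ExteriorAlgebra.ι R (x m))).prod

theorem ιMulti_succ' {k : ℕ} (x : Fin (k + 1) → L) :
    ExteriorAlgebra.ιMulti R (k + 1) x
      = ExteriorAlgebra.ι R (x 0) * ExteriorAlgebra.ιMulti R k (fun m => x m.succ) :=
  ExteriorAlgebra.ιMulti_succ_apply x

theorem wedgeOmit_succ_succ {k : ℕ} (x : Fin (k + 1) → L) (i j : Fin k) :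
    wedgeOmit R x i.succ j.succ
      = ExteriorAlgebra.ι R (x 0) * wedgeOmit R (fun m => x m.succ) i j := by
  unfold wedgeOmit
  rw [List.finRange_succ, List.filter_cons_of_pos (by simp [(Fin.succ_ne_zero _).symm]),
    List.map_cons, List.prod_cons, List.filter_map, List.map_map]
  congr 4
  ext m
  simp

theorem wedgeOmit_zero_succ {k : ℕ} (x : Fin (k + 1) → L) (j : Fin k) :
    wedgeOmit R x 0 j.succ = wedgeOmit R (fun m => x m.succ) j j := by
  unfold wedgeOmit
  rw [List.finRange_succ, List.filter_cons_of_neg (by simp), List.filter_map, List.map_map]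
  congr 3
  ext m
  simp

theorem wedgeOmit_zero_zero {k : ℕ} (x : Fin (k + 1) → L) :
    wedgeOmit R x 0 0 = ExteriorAlgebra.ιMulti R k (fun m => x m.succ) := by
  unfold wedgeOmit
  rw [List.finRange_succ, List.filter_cons_of_neg (by simp), List.filter_map, List.map_map,
    ExteriorAlgebra.ιMulti_apply, List.ofFn_eq_map, List.filter_eq_self.2 (by simp)]
  rfl

theorem ι_mul_ι_mul (x y : L) (a : ExteriorAlgebra R L) :
    ExteriorAlgebra.ι R x * (ExteriorAlgebra.ι R y * a)
      = -(ExteriorAlgebra.ι R y * (ExteriorAlgebra.ι R x * a)) := by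
  rw [eq_neg_iff_add_eq_zero, ← mul_assoc, ← mul_assoc, ← add_mul,
    ExteriorAlgebra.ι_add_mul_swap, zero_mul]

theorem adAction_wedge (y : L) {k : ℕ} (x : Fin k → L) :
    adAction R y (ExteriorAlgebra.ιMulti R k x)
      = ∑ j : Fin k, (-1 : ℤ) ^ (j : ℕ) •
          (ExteriorAlgebra.ι R ⁅y, x j⁆ * wedgeOmit R x j j) := by
  induction k with
  | zero => simp [adAction_one]
  | succ k ih =>
    rw [ιMulti_succ', adAction_ι_mul, ih, Fin.sum_univ_succ, wedgeOmit_zero_zero, Finset.mul_sum]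
    congr 1
    · simp
    · refine Finset.sum_congr rfl fun j _ => ?_
      rw [wedgeOmit_succ_succ, ι_mul_ι_mul ⁅y, x j.succ⁆, Fin.val_succ, pow_succ, mul_smul_comm]
      simp

/-- The closed formula for the Chevalley–Eilenberg boundary. -/
theorem boundary_wedge {k : ℕ} (x : Fin k → L) :
    boundary R L (ExteriorAlgebra.ιMulti R k x)
      = ∑ i : Fin k, ∑ j ∈ Finset.Ioi i, (-1 : ℤ) ^ ((i : ℕ) + (j : ℕ)) •
          (ExteriorAlgebra.ι R ⁅x i, x j⁆ * wedgeOmit R x i j) := by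
  induction k with
  | zero => simp [boundary_one]
  | succ k ih =>
    rw [ιMulti_succ', boundary_ι_mul, ih, adAction_wedge, Fin.sum_univ_succ, neg_add]
    congr 1
    · rw [Fin.Ioi_zero_eq_map, Finset.sum_map, ← Finset.sum_neg_distrib]
      refine Finset.sum_congr rfl fun j _ => ?_
      simp [wedgeOmit_zero_succ, pow_succ]
    · rw [Finset.mul_sum, ← Finset.sum_neg_distrib]
      refine Finset.sum_congr rfl fun i _ => ?_
      rw [Finset.mul_sum, ← Finset.sum_neg_distrib, Fin.Ioi_succ, Finset.sum_map]
      refine Finset.sum_congr rfl fun j _ => ?_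
      simp only [Fin.coe_succEmb, Fin.val_succ]
      rw [wedgeOmit_succ_succ, ι_mul_ι_mul ⁅x i.succ, x j.succ⁆, mul_smul_comm, smul_neg]
      congr 2
      ring

/-- The chain complex with modules `C k` and the restriction of the Chevalley–Eilenberg boundary,
for submodules `C k` of the exterior algebra that are compatible with the boundary. -/
noncomputable def complexOf {R : Type u} {L : Type v} [CommRing R] [LieRing L] [LieAlgebra R L]
    (C : ℕ → Submodule R (ExteriorAlgebra R L))
    (hC : ∀ k, ∀ a ∈ C (k + 1), boundary R L a ∈ C k) :
    ChainComplex (ModuleCat.{max u v} R) ℕ :=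
  ChainComplex.of (fun k => ModuleCat.of R (C k))
    (fun k => ModuleCat.ofHom ((boundary R L).restrict (hC k)))
    (fun _ => ModuleCat.hom_ext (LinearMap.ext fun a =>
      Subtype.ext (boundary_boundary (a : ExteriorAlgebra R L))))

/-- The inclusion of chain complexes given by submodules `C k ≤ D k`. -/
noncomputable def complexIncl {R : Type u} {L : Type v} [CommRing R] [LieRing L] [LieAlgebra R L]
    {C D : ℕ → Submodule R (ExteriorAlgebra R L)}
    (hC : ∀ k, ∀ a ∈ C (k + 1), boundary R L a ∈ C k)
    (hD : ∀ k, ∀ a ∈ D (k + 1), boundary R L a ∈ D k) (h : ∀ k, C k ≤ D k) :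
    complexOf C hC ⟶ complexOf D hD :=
  ChainComplex.ofHom (X := complexOf C hC) (Y := complexOf D hD)
    (fun k => ModuleCat.ofHom (Submodule.inclusion (h k)))
    (fun k => by
      unfold complexOf
      dsimp only [ChainComplex.of]
      rw [ChainComplex.of_d, ChainComplex.of_d]
      rfl)

theorem ι_mul_mem_exteriorPower {k : ℕ} (x : L) {a : ExteriorAlgebra R L}
    (ha : a ∈ ⋀[R]^k L) : ExteriorAlgebra.ι R x * a ∈ ⋀[R]^(k + 1) L := by
  rw [ExteriorAlgebra.exteriorPower, pow_succ']
  exact Submodule.mul_mem_mul (LinearMap.mem_range_self _ x) ha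

theorem adAction_mem_exteriorPower {k : ℕ} (y : L) {a : ExteriorAlgebra R L}
    (ha : a ∈ ⋀[R]^k L) : adAction R y a ∈ ⋀[R]^k L := by
  rw [← ExteriorAlgebra.ιMulti_span_fixedDegree] at ha
  induction ha using Submodule.span_induction with
  | zero => simp
  | add a b _ _ ha hb => rw [map_add]; exact add_mem ha hb
  | smul c a _ ha => rw [map_smul]; exact Submodule.smul_mem _ c ha
  | mem a ha =>
    obtain ⟨x, rfl⟩ := ha
    induction k with
    | zero => simp [adAction_one]
    | succ k ih =>
      rw [ιMulti_succ', adAction_ι_mul]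
      exact add_mem
        (ι_mul_mem_exteriorPower _ (ExteriorAlgebra.ιMulti_range R k ⟨_, rfl⟩))
        (ι_mul_mem_exteriorPower _ (ih _))

theorem boundary_mem_exteriorPower (k : ℕ) (a : ExteriorAlgebra R L)
    (ha : a ∈ ⋀[R]^(k + 1) L) : boundary R L a ∈ ⋀[R]^k L := by
  rw [← ExteriorAlgebra.ιMulti_span_fixedDegree] at ha
  induction ha using Submodule.span_induction with
  | zero => simp
  | add a b _ _ ha hb => rw [map_add]; exact add_mem ha hb
  | smul c a _ ha => rw [map_smul]; exact Submodule.smul_mem _ c ha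
  | mem a ha =>
    obtain ⟨x, rfl⟩ := ha
    induction k with
    | zero =>
      rw [ιMulti_succ', boundary_ι_mul, ExteriorAlgebra.ιMulti_zero_apply, adAction_one,
        boundary_one, mul_zero, add_zero, neg_zero]
      exact zero_mem _
    | succ k ih =>
      rw [ιMulti_succ', boundary_ι_mul]
      exact neg_mem (add_mem
        (adAction_mem_exteriorPower _ (ExteriorAlgebra.ιMulti_range R _ ⟨_, rfl⟩))
        (ι_mul_mem_exteriorPower _ (ih _)))

/-- The Chevalley–Eilenberg complex `⋀^* L` with trivial coefficients; its homology is
`H_*(L; R)` when `L` is free over `R`. -/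
noncomputable def chevalleyEilenberg (R : Type u) (L : Type v) [CommRing R] [LieRing L]
    [LieAlgebra R L] : ChainComplex (ModuleCat.{max u v} R) ℕ :=
  complexOf (fun k => ⋀[R]^k L) boundary_mem_exteriorPower

end General

/-! ## Strictly upper triangular integral matrices -/

section Nil

attribute [local instance] LieRing.ofAssociativeRing

/-- The Lie ring `nil_n` of strictly upper triangular integral `n × n` matrices. -/
def nil (n : ℕ) : LieSubalgebra ℤ (Matrix (Fin n) (Fin n) ℤ) where
  carrier := {A | ∀ i j, j ≤ i → A i j = 0}
  zero_mem' := fun _ _ _ => rfl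
  add_mem' := fun {A B} hA hB i j h => by simp [hA i j h, hB i j h]
  smul_mem' := fun c A hA i j h => by simp [hA i j h]
  lie_mem' := fun {A B} hA hB i j h => by
    have key : ∀ X Y : Matrix (Fin n) (Fin n) ℤ, (∀ i j, j ≤ i → X i j = 0) →
        (∀ i j, j ≤ i → Y i j = 0) → (X * Y) i j = 0 := by
      intro X Y hX hY
      rw [Matrix.mul_apply]
      refine Finset.sum_eq_zero fun m _ => ?_
      rcases le_total m i with hm | hm
      · rw [hX i m hm, zero_mul]
      · rw [hY m j (h.trans hm), mul_zero]
    rw [Ring.lie_def, Matrix.sub_apply, key A B hA hB, key B A hB hA, sub_zero]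

/-- The positions `(a, b)` with `a < b`, which index the basis `e_{ab}` of `nil_n`. -/
abbrev Pos (n : ℕ) : Type := {p : Fin n × Fin n // p.1 < p.2}

/-- The matrix unit `e_{ab}`. -/
def e {n : ℕ} (p : Pos n) : nil n :=
  ⟨Matrix.single p.1.1 p.1.2 1, fun i j h => by
    rw [Matrix.single_apply]
    refine if_neg ?_
    rintro ⟨rfl, rfl⟩
    exact absurd p.2 (not_lt.2 h)⟩

/-- The weight of the wedge `e_{a₁b₁} ∧ ⋯ ∧ e_{aₖbₖ}`: the number of times that `i` appears on the
right minus the number of times that it appears on the left. -/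
def weight {n k : ℕ} (p : Fin k → Pos n) (i : Fin n) : ℤ :=
  (Finset.card {m : Fin k | (p m).1.2 = i} : ℤ) - (Finset.card {m : Fin k | (p m).1.1 = i} : ℤ)

/-- The span in `⋀^k nil_n` of the wedges `e_{a₁b₁} ∧ ⋯ ∧ e_{aₖbₖ}` of weight `l`. (Wedges with a
repeated factor vanish, so these are the basis elements of weight `l`, up to sign.) -/
noncomputable def weightSpan (n : ℕ) (l : Fin n → ℤ) (k : ℕ) :
    Submodule ℤ (ExteriorAlgebra ℤ (nil n)) :=
  Submodule.span ℤ
    {a | ∃ p : Fin k → Pos n, weight p = l ∧ a = ExteriorAlgebra.ιMulti ℤ k (fun m => e (p m))}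

/-- The weight of a single matrix unit. -/
def root {n : ℕ} (s : Pos n) (i : Fin n) : ℤ :=
  (if s.1.2 = i then 1 else 0) - (if s.1.1 = i then 1 else 0)

theorem weight_succ {n k : ℕ} (p : Fin (k + 1) → Pos n) :
    weight p = root (p 0) + weight (fun m => p m.succ) := by
  ext i
  simp only [weight, root, Pi.add_apply, Finset.card_filter, Fin.sum_univ_succ]
  push_cast
  ring

theorem lie_e {n : ℕ} (s t : Pos n) :
    ⁅e s, e t⁆ = 0 ∨
      ∃ (c : ℤ) (r : Pos n), ⁅e s, e t⁆ = c • e r ∧ root r = root s + root t := by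
  obtain ⟨⟨a, b⟩, hab⟩ := s
  obtain ⟨⟨c, d⟩, hcd⟩ := t
  simp only at hab hcd
  by_cases hbc : b = c
  · subst hbc
    refine Or.inr ⟨1, ⟨(a, d), hab.trans hcd⟩, ?_, ?_⟩
    · apply Subtype.ext
      rw [one_smul]
      simp [e, Ring.lie_def, (hab.trans hcd).ne']
    · ext i; simp [root]
  · by_cases had : a = d
    · subst had
      refine Or.inr ⟨-1, ⟨(c, b), hcd.trans hab⟩, ?_, ?_⟩
      · apply Subtype.ext
        simp [e, Ring.lie_def, hbc]
      · ext i; simp [root]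
    · left
      apply Subtype.ext
      simp [e, Ring.lie_def, hbc, Ne.symm had]

theorem ι_mul_mem_weightSpan {n k : ℕ} {l : Fin n → ℤ} (s : Pos n)
    {a : ExteriorAlgebra ℤ (nil n)} (ha : a ∈ weightSpan n l k) :
    ExteriorAlgebra.ι ℤ (e s) * a ∈ weightSpan n (root s + l) (k + 1) := by
  induction ha using Submodule.span_induction with
  | zero => simp
  | add a b _ _ ha hb => rw [mul_add]; exact add_mem ha hb
  | smul c a _ ha => rw [mul_smul_comm]; exact Submodule.smul_mem _ c ha
  | mem a ha =>
    obtain ⟨p, rfl, rfl⟩ := ha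
    refine Submodule.subset_span ⟨Fin.cons s p, ?_, ?_⟩
    · rw [weight_succ]; simp
    · rw [ιMulti_succ']; simp

theorem adAction_mem_weightSpan {n k : ℕ} {l : Fin n → ℤ} (s : Pos n)
    {a : ExteriorAlgebra ℤ (nil n)} (ha : a ∈ weightSpan n l k) :
    adAction ℤ (e s) a ∈ weightSpan n (root s + l) k := by
  induction ha using Submodule.span_induction with
  | zero => simp
  | add a b _ _ ha hb => rw [map_add]; exact add_mem ha hb
  | smul c a _ ha => rw [map_smul]; exact Submodule.smul_mem _ c ha
  | mem a ha =>
    obtain ⟨p, rfl, rfl⟩ := ha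
    induction k with
    | zero => simp [adAction_one]
    | succ k ih =>
      rw [ιMulti_succ', adAction_ι_mul]
      refine add_mem ?_ ?_
      · rcases lie_e s (p 0) with h | ⟨c, r, h, hr⟩
        · simp [h]
        · rw [h, map_smul, smul_mul_assoc, weight_succ, ← add_assoc, ← hr]
          exact Submodule.smul_mem _ c
            (ι_mul_mem_weightSpan r (Submodule.subset_span ⟨_, rfl, rfl⟩))
      · rw [weight_succ, add_left_comm]
        exact ι_mul_mem_weightSpan _ (ih _)

theorem boundary_mem_weightSpan {n : ℕ} (l : Fin n → ℤ) (k : ℕ)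
    (a : ExteriorAlgebra ℤ (nil n)) (ha : a ∈ weightSpan n l (k + 1)) :
    boundary ℤ (nil n) a ∈ weightSpan n l k := by
  induction ha using Submodule.span_induction with
  | zero => simp
  | add a b _ _ ha hb => rw [map_add]; exact add_mem ha hb
  | smul c a _ ha => rw [map_smul]; exact Submodule.smul_mem _ c ha
  | mem a ha =>
    obtain ⟨p, rfl, rfl⟩ := ha
    induction k with
    | zero =>
      rw [ιMulti_succ', boundary_ι_mul, ExteriorAlgebra.ιMulti_zero_apply, adAction_one,
        boundary_one, mul_zero, add_zero, neg_zero]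
      exact zero_mem _
    | succ k ih =>
      rw [ιMulti_succ', boundary_ι_mul, weight_succ]
      exact neg_mem (add_mem
        (adAction_mem_weightSpan _ (Submodule.subset_span ⟨_, rfl, rfl⟩))
        (ι_mul_mem_weightSpan _ (ih _)))

theorem weightSpan_le {n : ℕ} (l : Fin n → ℤ) (k : ℕ) :
    weightSpan n l k ≤ ⋀[ℤ]^k (nil n) := by
  refine Submodule.span_le.2 ?_
  rintro _ ⟨p, _, rfl⟩
  exact ExteriorAlgebra.ιMulti_range ℤ k ⟨_, rfl⟩

/-- The weight vector `(1, …, n) - w`, where `w` is a modified weight vector. -/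
def unmodify {n : ℕ} (w : Fin n → ℤ) (i : Fin n) : ℤ := ((i : ℤ) + 1) - w i

/-- The subcomplex `⟦w₁, …, wₙ⟧` of the Chevalley–Eilenberg complex of `nil_n`, spanned by the
wedges of modified weight `(1, …, n) - weight` equal to `w`. -/
noncomputable def bracket {n : ℕ} (w : Fin n → ℤ) : ChainComplex (ModuleCat.{0} ℤ) ℕ :=
  complexOf (weightSpan n (unmodify w)) (boundary_mem_weightSpan (unmodify w))

/-- The inclusion of `⟦w⟧` in the Chevalley–Eilenberg complex of `nil_n`. -/
noncomputable def bracketIncl {n : ℕ} (w : Fin n → ℤ) :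
    bracket w ⟶ chevalleyEilenberg ℤ (nil n) :=
  complexIncl (boundary_mem_weightSpan (unmodify w)) boundary_mem_exteriorPower
    (weightSpan_le (unmodify w))

/-- The vector `(2, 3, …, q+1, 2, q+1, q+3, …, n)`, for `q + 2 ≤ n`; the entry with index `i : Fin n`
is the one in position `i + 1`. -/
def torsionWeight (q n : ℕ) (i : Fin n) : ℤ :=
  if (i : ℕ) < q then (i : ℤ) + 2
  else if (i : ℕ) = q then 2
  else if (i : ℕ) = q + 1 then (q : ℤ) + 1
  else (i : ℤ) + 1

end Nil

end LieHomology

/-! Read `e_{ab}` as an edge from `a` to `b`, and number vertices from `0`. With `A = q` and `B = q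
+ 1`, the weight in question asks for net outflow one at each vertex below `A`, net inflow `A - 1`
at `A`, net inflow one at `B`, and balance elsewhere (`sinkWeight`). At most `A` distinct edges end
in `A`. Hence either all of them occur, and the remaining flow is the edge from `A` to `B`
(`apexGen`), or exactly one of them, from `v` say, is missing, and the remaining edges form an
increasing path from `v` to `B` that avoids `A` (`pathGen`). This is `weightSpan_sinkWeight`.

A path generator is thus a nonempty set of vertices below `A`, that is, a face of the simplex on `q`
vertices, with degree shifted by `A`. Brackets of consecutive edges delete a vertex other than the
first, and the bracket of the first edge with an edge into `A` deletes the first vertex. So the path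
generators span the simplicial chains of a simplex (`boundary_pathGen`). The apex generator, in
degree `A + 1`, has boundary plus or minus the sum of all vertices (`boundary_apexGen`).

The simplex is contractible: prepending the least vertex `o` is a cone homotopy (`homotopy_pathGen`,
`boundary_prepend_self`). What remains is `ℤ` in degree `q`, detected by the augmentation `ε`
(`exists_augmentation`), modulo the apex boundary, whose augmentation is `±q`. This gives `ℤ/q` in
degree `q`; since `q ≠ 0`, no cycle involves the apex, and nothing survives above.

For the summand, the exterior algebra is graded by weight and the boundary preserves weights, so the
projection to one weight is a chain map that splits the inclusion (`isSplitMono_bracketIncl`).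
Homology preserves this splitting. -/

namespace LieHomology

/-! ### Contractions and wedges of lists in an exterior algebra -/

section Contraction

variable {R L : Type*} [CommRing R] [LieRing L] [LieAlgebra R L]

/-- Right contraction of the exterior algebra by a linear form. -/
noncomputable def contractR (d : Module.Dual R L) : ExteriorAlgebra R L →ₗ[R] ExteriorAlgebra R L :=
  (CliffordAlgebra.contractRight (Q := (0 : QuadraticForm R L))).flip d

/-- Left contraction of the exterior algebra by a linear form. -/
noncomputable def contractL (d : Module.Dual R L) : ExteriorAlgebra R L →ₗ[R] ExteriorAlgebra R L :=
  CliffordAlgebra.contractLeft (Q := (0 : QuadraticForm R L)) d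

theorem contractL_ι_mul (d : Module.Dual R L) (x : L) (a : ExteriorAlgebra R L) :
    contractL d (ExteriorAlgebra.ι R x * a) = d x • a - ExteriorAlgebra.ι R x * contractL d a :=
  CliffordAlgebra.contractLeft_ι_mul d x a

theorem contractL_one (d : Module.Dual R L) : contractL d (1 : ExteriorAlgebra R L) = 0 :=
  CliffordAlgebra.contractLeft_one (Q := (0 : QuadraticForm R L)) d

theorem contractR_mul_ι (d : Module.Dual R L) (x : L) (a : ExteriorAlgebra R L) :
    contractR d (a * ExteriorAlgebra.ι R x) = d x • a - contractR d a * ExteriorAlgebra.ι R x :=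
  CliffordAlgebra.contractRight_mul_ι d x a

theorem contractR_algebraMap (d : Module.Dual R L) (r : R) :
    contractR d (algebraMap R (ExteriorAlgebra R L) r) = 0 :=
  CliffordAlgebra.contractRight_algebraMap (Q := (0 : QuadraticForm R L)) d r

theorem contractR_one (d : Module.Dual R L) : contractR d (1 : ExteriorAlgebra R L) = 0 :=
  CliffordAlgebra.contractRight_one (Q := (0 : QuadraticForm R L)) d

theorem contractR_ι (d : Module.Dual R L) (x : L) :
    contractR d (ExteriorAlgebra.ι R x) = algebraMap R (ExteriorAlgebra R L) (d x) :=
  CliffordAlgebra.contractRight_ι (Q := (0 : QuadraticForm R L)) d x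

theorem contractR_contractR (d : Module.Dual R L) (a : ExteriorAlgebra R L) :
    contractR d (contractR d a) = 0 :=
  CliffordAlgebra.contractRight_contractRight (Q := (0 : QuadraticForm R L)) d a

/-- Right induction on the exterior algebra. -/
theorem wedge_induction_right {P : ExteriorAlgebra R L → Prop}
    (h0 : ∀ r : R, P (algebraMap R _ r)) (hadd : ∀ a b, P a → P b → P (a + b))
    (hmul : ∀ (x : L) (a : ExteriorAlgebra R L), P a → P (a * ExteriorAlgebra.ι R x))
    (a : ExteriorAlgebra R L) : P a :=
  CliffordAlgebra.right_induction (Q := (0 : QuadraticForm R L)) h0 hadd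
    (fun x a ha => hmul x a ha) a

/-- Right contraction is a signed derivation that starts at the right end, so passing to the factor
`b` costs no sign. This is why contraction is taken on the right. -/
theorem contractR_mul_of_eq_zero {d : Module.Dual R L} {a : ExteriorAlgebra R L}
    (ha : contractR d a = 0) (b : ExteriorAlgebra R L) :
    contractR d (a * b) = a * contractR d b := by
  induction b using wedge_induction_right with
  | h0 r => rw [← Algebra.commutes, ← Algebra.smul_def, map_smul, ha, contractR_algebraMap]; simp
  | hadd b c hb hc => simp only [mul_add, map_add, hb, hc]
  | hmul x b hb =>
    rw [← mul_assoc, contractR_mul_ι, hb, contractR_mul_ι, mul_sub, mul_smul_comm, mul_assoc]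

theorem contractR_ι_mul_of_eq_zero {d : Module.Dual R L} {x : L} (hx : d x = 0)
    (b : ExteriorAlgebra R L) :
    contractR d (ExteriorAlgebra.ι R x * b) = ExteriorAlgebra.ι R x * contractR d b :=
  contractR_mul_of_eq_zero (by rw [contractR_ι, hx, map_zero]) b

theorem mul_ι_mul_ι (x y : L) (a : ExteriorAlgebra R L) :
    a * ExteriorAlgebra.ι R x * ExteriorAlgebra.ι R y
      = -(a * ExteriorAlgebra.ι R y * ExteriorAlgebra.ι R x) := by
  rw [eq_neg_iff_add_eq_zero, mul_assoc, mul_assoc, ← mul_add,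
    ExteriorAlgebra.ι_add_mul_swap, mul_zero]

theorem adAction_mul (x : L) (a b : ExteriorAlgebra R L) :
    adAction R x (a * b) = adAction R x a * b + a * adAction R x b := by
  induction a using wedge_induction with
  | h0 r => simp [adAction_algebraMap, ← Algebra.smul_def]
  | hadd a c ha hc => simp only [add_mul, map_add, ha, hc]; abel
  | hmul y a ha => simp only [mul_assoc, adAction_ι_mul, ha, add_mul, mul_add]; abel

theorem adAction_ι (x y : L) :
    adAction R x (ExteriorAlgebra.ι R y) = ExteriorAlgebra.ι R ⁅x, y⁆ := by
  simpa [adAction_one] using adAction_ι_mul (R := R) x y 1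

theorem adAction_mul_ι (x y : L) (a : ExteriorAlgebra R L) :
    adAction R x (a * ExteriorAlgebra.ι R y)
      = adAction R x a * ExteriorAlgebra.ι R y + a * ExteriorAlgebra.ι R ⁅x, y⁆ := by
  rw [adAction_mul, adAction_ι]

/-- The wedge of the entries of a list. -/
noncomputable def wedgeList (R : Type*) {L : Type*} [CommRing R] [LieRing L] [LieAlgebra R L]
    (l : List L) : ExteriorAlgebra R L :=
  (l.map (ExteriorAlgebra.ι R)).prod

@[simp] theorem wedgeList_nil : wedgeList R ([] : List L) = 1 := rfl

@[simp] theorem wedgeList_cons (x : L) (l : List L) :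
    wedgeList R (x :: l) = ExteriorAlgebra.ι R x * wedgeList R l := by
  simp [wedgeList]

@[simp] theorem wedgeList_append (l l' : List L) :
    wedgeList R (l ++ l') = wedgeList R l * wedgeList R l' := by
  simp [wedgeList]

/-- Used only to prove membership in spans, so the sign need not be tracked. -/
theorem wedgeList_perm {l l' : List L} (h : l.Perm l') :
    wedgeList R l = wedgeList R l' ∨ wedgeList R l = -wedgeList R l' := by
  induction h with
  | nil => simp
  | cons x _ ih => rcases ih with ih | ih <;> simp [ih]
  | swap x y l => right; simp only [wedgeList_cons]; rw [ι_mul_ι_mul]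
  | trans _ _ h1 h2 => rcases h1 with h1 | h1 <;> rcases h2 with h2 | h2 <;> simp [h1, h2]

theorem ιMulti_eq_wedgeList {k : ℕ} (x : Fin k → L) :
    ExteriorAlgebra.ιMulti R k x = wedgeList R (List.ofFn x) := by
  rw [ExteriorAlgebra.ιMulti_apply, wedgeList, List.map_ofFn]; rfl

theorem ι_mul_wedgeList_of_mem {x : L} {l : List L} (h : x ∈ l) :
    ExteriorAlgebra.ι R x * wedgeList R l = 0 := by
  induction l with
  | nil => simp at h
  | cons y l ih =>
    rw [wedgeList_cons]
    rcases List.mem_cons.1 h with rfl | h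
    · rw [← mul_assoc, ExteriorAlgebra.ι_sq_zero, zero_mul]
    · rw [ι_mul_ι_mul, ih h, mul_zero, neg_zero]

theorem wedgeList_mul_ι (x : L) (l : List L) :
    wedgeList R l * ExteriorAlgebra.ι R x
      = (-1 : ℤ) ^ l.length • (ExteriorAlgebra.ι R x * wedgeList R l) := by
  induction l with
  | nil => simp
  | cons y l ih =>
    rw [wedgeList_cons, mul_assoc, ih, List.length_cons, pow_succ, mul_smul_comm, ι_mul_ι_mul]
    simp

theorem wedgeList_mul_ι_of_mem {x : L} {l : List L} (h : x ∈ l) :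
    wedgeList R l * ExteriorAlgebra.ι R x = 0 := by
  rw [wedgeList_mul_ι, ι_mul_wedgeList_of_mem h, smul_zero]

end Contraction

/-! ### Stars, paths and their boundaries -/

section PathWedges

attribute [local instance] LieRing.ofAssociativeRing

variable {n : ℕ}

/-- The matrix unit `e_{ab}` if `a < b`, and zero otherwise. -/
def eu (a b : Fin n) : nil n := if h : a < b then e ⟨(a, b), h⟩ else 0

theorem eu_of_lt {a b : Fin n} (h : a < b) : eu a b = e ⟨(a, b), h⟩ := dif_pos h

theorem eu_of_not_lt {a b : Fin n} (h : ¬ a < b) : eu a b = 0 := dif_neg h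

theorem eu_val {a b : Fin n} (h : a < b) :
    (eu a b : Matrix (Fin n) (Fin n) ℤ) = Matrix.single a b 1 := by
  rw [eu_of_lt h]; rfl

theorem lie_eu_eu {a b c : Fin n} (hab : a < b) (hbc : b < c) : ⁅eu a b, eu b c⁆ = eu a c := by
  apply Subtype.ext
  rw [LieSubalgebra.coe_bracket, eu_val hab, eu_val hbc, eu_val (hab.trans hbc)]
  simp [Ring.lie_def, (hab.trans hbc).ne']

theorem lie_eu_of_ne {a b c d : Fin n} (hbc : b ≠ c) (had : a ≠ d) : ⁅eu a b, eu c d⁆ = 0 := by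
  by_cases hab : a < b
  · by_cases hcd : c < d
    · apply Subtype.ext
      rw [LieSubalgebra.coe_bracket, eu_val hab, eu_val hcd]
      simp [Ring.lie_def, hbc, had.symm]
    · rw [eu_of_not_lt hcd, lie_zero]
  · rw [eu_of_not_lt hab, zero_lie]

/-- The linear form on `nil_n` that reads off the entry at `(a, b)`. -/
def entry (a b : Fin n) : Module.Dual ℤ (nil n) where
  toFun M := (M : Matrix (Fin n) (Fin n) ℤ) a b
  map_add' _ _ := rfl
  map_smul' _ _ := rfl

theorem entry_eu_self {a b : Fin n} (h : a < b) : entry a b (eu a b) = 1 := by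
  change (eu a b : Matrix (Fin n) (Fin n) ℤ) a b = 1
  rw [eu_val h, Matrix.single_apply_same]

theorem entry_eu_of_ne_left {a b c d : Fin n} (h : c ≠ a) : entry a b (eu c d) = 0 := by
  change (eu c d : Matrix (Fin n) (Fin n) ℤ) a b = 0
  by_cases hcd : c < d
  · rw [eu_val hcd, Matrix.single_apply_of_row_ne h]
  · rw [eu_of_not_lt hcd]; rfl

theorem entry_eu_of_ne_right {a b c d : Fin n} (h : d ≠ b) : entry a b (eu c d) = 0 := by
  change (eu c d : Matrix (Fin n) (Fin n) ℤ) a b = 0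
  by_cases hcd : c < d
  · rw [eu_val hcd, Matrix.single_apply_of_col_ne c a h]
  · rw [eu_of_not_lt hcd]; rfl

/-- The wedge of the `e_{iA}` for `i` in a list. -/
noncomputable def star (A : Fin n) (S : List (Fin n)) : ExteriorAlgebra ℤ (nil n) :=
  wedgeList ℤ (S.map fun i => eu i A)

theorem star_cons (A i : Fin n) (S : List (Fin n)) :
    star A (i :: S) = ExteriorAlgebra.ι ℤ (eu i A) * star A S := by
  simp [star]

theorem star_concat (A i : Fin n) (S : List (Fin n)) :
    star A (S ++ [i]) = star A S * ExteriorAlgebra.ι ℤ (eu i A) := by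
  simp [star]

theorem star_mul_ι (A : Fin n) (S : List (Fin n)) (x : nil n) :
    star A S * ExteriorAlgebra.ι ℤ x
      = (-1 : ℤ) ^ S.length • (ExteriorAlgebra.ι ℤ x * star A S) := by
  simp [star, wedgeList_mul_ι]

theorem contractR_star_of_notMem {A i : Fin n} {S : List (Fin n)} (h : i ∉ S) :
    contractR (entry i A) (star A S) = 0 := by
  induction S with
  | nil => exact contractR_one _
  | cons j S ih =>
    rw [List.mem_cons, not_or] at h
    rw [star_cons, contractR_ι_mul_of_eq_zero (entry_eu_of_ne_left (Ne.symm h.1)), ih h.2, mul_zero]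

theorem contractL_star_of_notMem {A i : Fin n} {S : List (Fin n)} (h : i ∉ S) :
    contractL (entry i A) (star A S) = 0 := by
  induction S with
  | nil => exact contractL_one _
  | cons j S ih =>
    rw [List.mem_cons, not_or] at h
    rw [star_cons, contractL_ι_mul, entry_eu_of_ne_left (Ne.symm h.1), ih h.2, mul_zero, zero_smul,
      sub_zero]

theorem contractR_star {A i : Fin n} (hi : i < A) {S : List (Fin n)} (hS : S.Nodup) (h : i ∈ S) :
    contractR (entry i A) (star A S) = star A (S.erase i) ∨
      contractR (entry i A) (star A S) = -star A (S.erase i) := by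
  induction S with
  | nil => simp at h
  | cons j S ih =>
    rw [List.nodup_cons] at hS
    by_cases hij : j = i
    · subst hij
      have hs : ExteriorAlgebra.ι ℤ (eu j A) * star A S
          = (-1 : ℤ) ^ S.length • (star A S * ExteriorAlgebra.ι ℤ (eu j A)) := by
        rw [star_mul_ι, smul_smul, ← mul_pow]; simp
      rw [star_cons, hs, map_zsmul, contractR_mul_ι, entry_eu_self hi,
        contractR_star_of_notMem hS.1, zero_mul, sub_zero, one_smul, List.erase_cons_head]
      rcases neg_one_pow_eq_or ℤ S.length with h | h <;> simp [h]
    · have hm : i ∈ S := by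
        rcases List.mem_cons.1 h with h | h
        · exact absurd h.symm hij
        · exact h
      rw [star_cons, contractR_ι_mul_of_eq_zero (entry_eu_of_ne_left hij),
        List.erase_cons_tail (by simpa using hij), star_cons]
      rcases ih hS.2 hm with h | h <;> simp [h]

/-- Among the brackets of `e_{uv}` with the factors `e_{iA}`, only `⁅e_{uv}, e_{vA}⁆ = e_{uA}`
survives. Contraction brings the factor `e_{vA}` to the right end, where `e_{uA}` takes its place.
-/
theorem adAction_eu_star {A u v : Fin n} (huA : u < A) (huv : u < v) {S : List (Fin n)}
    (hS : ∀ i ∈ S, i < A) :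
    adAction ℤ (eu u v) (star A S)
      = contractR (entry v A) (star A S) * ExteriorAlgebra.ι ℤ (eu u A) := by
  induction S using List.reverseRecOn with
  | nil => change adAction ℤ _ 1 = contractR _ 1 * _; rw [contractR_one, adAction_one, zero_mul]
  | append_singleton S i ih =>
    have hi : i < A := hS i (by simp)
    rw [star_concat, adAction_mul_ι, contractR_mul_ι, ih fun j hj => hS j (by simp [hj]), sub_mul,
      mul_ι_mul_ι (eu i A) (eu u A)]
    by_cases hvi : v = i
    · subst hvi
      rw [lie_eu_eu huv hi, entry_eu_self hi, one_smul]; abel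
    · rw [lie_eu_of_ne hvi huA.ne, entry_eu_of_ne_left (Ne.symm hvi)]; simp

/-- The `e_{iA}` with `i < A` commute with each other. -/
theorem boundary_star {A : Fin n} {S : List (Fin n)} (hS : ∀ i ∈ S, i < A) :
    boundary ℤ (nil n) (star A S) = 0 := by
  induction S with
  | nil => exact boundary_one
  | cons i S ih =>
    have h : ∀ j ∈ S, j < A := fun j hj => hS j (by simp [hj])
    have hi : i < A := hS i (by simp)
    rw [star_cons, boundary_ι_mul, ih h, adAction_eu_star hi hi h,
      contractR_star_of_notMem (fun hA => (h A hA).false)]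
    simp

/-- The vertices below `A`, in increasing order. -/
def below (A : Fin n) : List (Fin n) := (List.finRange n).filter (· < A)

theorem mem_below {A i : Fin n} : i ∈ below A ↔ i < A := by simp [below]

theorem nodup_below (A : Fin n) : (below A).Nodup := (List.nodup_finRange n).filter _

theorem length_below (A : Fin n) : (below A).length = A := by
  rw [← List.toFinset_card_of_nodup (nodup_below A)]
  have : (below A).toFinset = Finset.Iio A := by ext i; simp [mem_below]
  rw [this, Fin.card_Iio]

/-- The wedge of all `e_{iA}` with one factor removed, signed by contraction. -/
noncomputable def costar (A i : Fin n) : ExteriorAlgebra ℤ (nil n) :=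
  contractR (entry i A) (star A (below A))

theorem costar_eq {A i : Fin n} (hi : i < A) :
    costar A i = star A ((below A).erase i) ∨ costar A i = -star A ((below A).erase i) :=
  contractR_star hi (nodup_below A) (mem_below.2 hi)

theorem lt_of_mem_erase_below {A i j : Fin n} (h : j ∈ (below A).erase i) : j < A :=
  mem_below.1 (List.mem_of_mem_erase h)

theorem boundary_costar {A i : Fin n} (hi : i < A) : boundary ℤ (nil n) (costar A i) = 0 := by
  have := boundary_star (fun j (hj : j ∈ (below A).erase i) => lt_of_mem_erase_below hj)
  rcases costar_eq hi with h | h <;> simp [h, this]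

theorem star_below_mul_ι {A i : Fin n} (hi : i < A) :
    star A (below A) * ExteriorAlgebra.ι ℤ (eu i A) = 0 :=
  wedgeList_mul_ι_of_mem (List.mem_map.2 ⟨i, mem_below.2 hi, rfl⟩)

/-- Contract the relation `star ∧ e_{iA} = 0`. Defining `costar` by contraction fixes its sign so
that none appears here. -/
theorem costar_mul_ι_self {A i : Fin n} (hi : i < A) :
    costar A i * ExteriorAlgebra.ι ℤ (eu i A) = star A (below A) := by
  have := contractR_mul_ι (entry i A) (eu i A) (star A (below A))
  rw [star_below_mul_ι hi, map_zero, entry_eu_self hi, one_smul] at this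
  exact (sub_eq_zero.1 this.symm).symm

theorem costar_mul_ι_of_ne {A i j : Fin n} (hj : j < A) (hij : j ≠ i) :
    costar A i * ExteriorAlgebra.ι ℤ (eu j A) = 0 := by
  have := contractR_mul_ι (entry i A) (eu j A) (star A (below A))
  rw [star_below_mul_ι hj, map_zero, entry_eu_of_ne_left hij, zero_smul, zero_sub] at this
  exact neg_eq_zero.1 this.symm

theorem adAction_eu_costar {A i u v : Fin n} (hi : i < A) (huA : u < A) (huv : u < v) :
    adAction ℤ (eu u v) (costar A i)
      = contractR (entry v A) (costar A i) * ExteriorAlgebra.ι ℤ (eu u A) := by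
  have := adAction_eu_star huA huv (fun j (hj : j ∈ (below A).erase i) => lt_of_mem_erase_below hj)
  rcases costar_eq hi with h | h <;> simp [h, this]

theorem contractR_costar_mul_ι {A i u v : Fin n} (huv : u ≠ v) :
    contractR (entry v A) (costar A i) * ExteriorAlgebra.ι ℤ (eu u A)
      = -contractR (entry v A) (costar A i * ExteriorAlgebra.ι ℤ (eu u A)) := by
  rw [contractR_mul_ι, entry_eu_of_ne_left huv]; simp

/-- The action replaces `e_{vA}` by `e_{uA}`, which is already a factor when `u ≠ i`. -/
theorem adAction_eu_costar_of_ne {A i u : Fin n} (hi : i < A) (huA : u < A) (hui : u ≠ i)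
    (v : Fin n) : adAction ℤ (eu u v) (costar A i) = 0 := by
  by_cases huv : u < v
  · rw [adAction_eu_costar hi huA huv, contractR_costar_mul_ι huv.ne, costar_mul_ι_of_ne huA hui]
    simp
  · rw [eu_of_not_lt huv]; simp

/-- Here `e_{uA}` is the missing factor: replacing `e_{vA}` by it fills the gap at `u` and opens one
at `v`. For `v ≥ A` both sides vanish. -/
theorem adAction_eu_costar_self {A u v : Fin n} (huA : u < A) (huv : u < v) :
    adAction ℤ (eu u v) (costar A u) = -costar A v := by
  rw [adAction_eu_costar huA huA huv, contractR_costar_mul_ι huv.ne, costar_mul_ι_self huA, costar]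

theorem costar_of_le {A v : Fin n} (h : A ≤ v) : costar A v = 0 :=
  contractR_star_of_notMem (fun hv => (mem_below.1 hv).not_ge h)

/-- The wedge of the edges of the path that runs through the vertices in a list and ends
in `B`. -/
noncomputable def path (B : Fin n) : List (Fin n) → ExteriorAlgebra ℤ (nil n)
  | [] => 1
  | v :: L => ExteriorAlgebra.ι ℤ (eu v (L.headD B)) * path B L

theorem path_cons_cons (B u v : Fin n) (L : List (Fin n)) :
    path B (u :: v :: L) = ExteriorAlgebra.ι ℤ (eu u v) * path B (v :: L) := rfl

/-- A nonzero bracket needs an edge that starts in `b` or ends in `a`, and the whole path lies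
beyond `b`. -/
theorem adAction_eu_path {B a b : Fin n} (hab : a < b) {L : List (Fin n)} (hL : ∀ c ∈ L, b < c) :
    adAction ℤ (eu a b) (path B L) = 0 := by
  induction L with
  | nil => exact adAction_one _
  | cons c L ih =>
    have hc : b < c := hL c (by simp)
    rw [path, adAction_ι_mul, ih fun d hd => hL d (by simp [hd]), mul_zero, add_zero]
    by_cases h : c < L.headD B
    · rw [lie_eu_of_ne hc.ne (hab.trans (hc.trans h)).ne, map_zero, zero_mul]
    · rw [eu_of_not_lt h, lie_zero, map_zero, zero_mul]

theorem headD_lt {B v : Fin n} {L : List (Fin n)} (hL : (v :: L).Pairwise (· < ·)) (hv : v < B) :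
    v < L.headD B := by
  cases L with
  | nil => exact hv
  | cons w L => exact List.rel_of_pairwise_cons hL (by simp)

theorem adAction_eu_path_cons {B u v : Fin n} (huv : u < v) (hv : v < B) {L : List (Fin n)}
    (hL : (v :: L).Pairwise (· < ·)) :
    adAction ℤ (eu u v) (path B (v :: L)) = path B (u :: L) := by
  rw [path, adAction_ι_mul, adAction_eu_path huv (List.pairwise_cons.1 hL).1, mul_zero, add_zero,
    lie_eu_eu huv (headD_lt hL hv), path]

theorem boundary_path_singleton (B v : Fin n) : boundary ℤ (nil n) (path B [v]) = 0 := by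
  rw [path, path, boundary_ι_mul, boundary_one, adAction_one]
  simp

/-- Merging the first two edges deletes `v`. Iterated, this gives the alternating sum over the
deletions of any vertex but the first; the last listed vertex is included, since the path continues
to `B`. -/
theorem boundary_path_cons_cons {B u v : Fin n} (hv : v < B) {L : List (Fin n)}
    (hL : (u :: v :: L).Pairwise (· < ·)) :
    boundary ℤ (nil n) (path B (u :: v :: L))
      = -(path B (u :: L)
        + ExteriorAlgebra.ι ℤ (eu u v) * boundary ℤ (nil n) (path B (v :: L))) := by
  rw [path_cons_cons, boundary_ι_mul, adAction_eu_path_cons (List.rel_of_pairwise_cons hL (by simp))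
    hv (List.pairwise_cons.1 hL).2]

/-- The cross terms are actions of edges of the path on `b`, and these vanish. -/
theorem boundary_path_mul {B : Fin n} {L : List (Fin n)} {b : ExteriorAlgebra ℤ (nil n)}
    (hb : boundary ℤ (nil n) b = 0) (hL : ∀ u ∈ L, ∀ v, adAction ℤ (eu u v) b = 0) :
    boundary ℤ (nil n) (path B L * b) = boundary ℤ (nil n) (path B L) * b := by
  induction L with
  | nil => simp [path, hb, boundary_one]
  | cons u L ih =>
    rw [path, mul_assoc, boundary_ι_mul, ih fun v hv => hL v (by simp [hv]), adAction_mul,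
      hL u (by simp), mul_zero, add_zero, boundary_ι_mul, neg_mul, add_mul, mul_assoc]

/-- The generator given by a path with vertices below `A`, which ends in `B`: its edges, and all
edges into `A` from vertices other than the first one of the path. -/
noncomputable def pathGen (A B : Fin n) : List (Fin n) → ExteriorAlgebra ℤ (nil n)
  | [] => 0
  | v :: L => path B (v :: L) * costar A v

theorem boundary_pathGen_singleton {A B v : Fin n} (hv : v < A) (hAB : A < B) :
    boundary ℤ (nil n) (pathGen A B [v]) = 0 := by
  have h : adAction ℤ (eu v B) (costar A v) = 0 := by
    rw [adAction_eu_costar_self hv (hv.trans hAB), costar_of_le hAB.le, neg_zero]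
  simp [pathGen, path, boundary_ι_mul, h, boundary_costar hv]

/-- The one nonzero cross term is the action of the first edge `e_{uv}` on the star. It uses up that
edge and moves the gap from `u` to `v`, which is the face opposite to the first vertex; the first
summand collects the other faces. -/
theorem boundary_pathGen {A B u v : Fin n} (hAB : A < B) {L : List (Fin n)}
    (hL : (u :: v :: L).Pairwise (· < ·)) (hA : ∀ w ∈ u :: v :: L, w < A) :
    boundary ℤ (nil n) (pathGen A B (u :: v :: L))
      = boundary ℤ (nil n) (path B (u :: v :: L)) * costar A u + pathGen A B (v :: L) := by
  have hu : u < A := hA u (by simp)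
  have hv : v < A := hA v (by simp)
  have huv : u < v := List.rel_of_pairwise_cons hL (by simp)
  rw [pathGen, boundary_path_cons_cons (hv.trans hAB) hL, path_cons_cons, mul_assoc,
    boundary_ι_mul, adAction_mul,
    adAction_eu_path_cons huv (hv.trans hAB) (List.pairwise_cons.1 hL).2,
    adAction_eu_costar_self hu huv,
    boundary_path_mul (boundary_costar hu) fun w hw => adAction_eu_costar_of_ne hu
      (hA w (List.mem_cons_of_mem _ hw)) (List.rel_of_pairwise_cons hL hw).ne', pathGen]
  simp only [mul_neg, neg_mul, add_mul, mul_assoc]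
  abel

theorem contractR_path {A B o : Fin n} (hAB : A < B) {L : List (Fin n)} (hA : ∀ w ∈ L, w < A) :
    contractR (entry o A) (path B L) = 0 := by
  induction L with
  | nil => exact contractR_one _
  | cons u L ih =>
    have h : L.headD B ≠ A := by
      cases L with
      | nil => exact hAB.ne'
      | cons v L => exact (hA v (by simp)).ne
    rw [path, contractR_ι_mul_of_eq_zero (entry_eu_of_ne_right h),
      ih fun w hw => hA w (by simp [hw]), mul_zero]

theorem contractR_boundary_path {A B o u : Fin n} (hAB : A < B) {L : List (Fin n)}
    (hL : (u :: L).Pairwise (· < ·)) (hA : ∀ w ∈ u :: L, w < A) :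
    contractR (entry o A) (boundary ℤ (nil n) (path B (u :: L))) = 0 := by
  induction L generalizing u with
  | nil => rw [boundary_path_singleton, map_zero]
  | cons v L ih =>
    have hv : v < A := hA v (by simp)
    rw [boundary_path_cons_cons (hv.trans hAB) hL, map_neg, map_add,
      contractR_ι_mul_of_eq_zero (entry_eu_of_ne_right hv.ne),
      ih (List.pairwise_cons.1 hL).2 fun w hw => hA w (List.mem_cons_of_mem _ hw),
      contractR_path hAB fun w hw => hA w (by simp only [List.mem_cons] at hw ⊢; tauto)]
    simp

/-! ### The cone homotopy and the apex generator -/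

/-- The operator that prepends the vertex `o` to a path. -/
noncomputable def prepend (A o : Fin n) : ExteriorAlgebra ℤ (nil n) →ₗ[ℤ] ExteriorAlgebra ℤ (nil n) :=
  -∑ v ∈ Finset.Ioo o A, LinearMap.mulLeft ℤ (ExteriorAlgebra.ι ℤ (eu o v)) ∘ₗ
    LinearMap.mulRight ℤ (ExteriorAlgebra.ι ℤ (eu v A)) ∘ₗ contractR (entry o A)

theorem prepend_apply (A o : Fin n) (a : ExteriorAlgebra ℤ (nil n)) :
    prepend A o a = -∑ v ∈ Finset.Ioo o A, ExteriorAlgebra.ι ℤ (eu o v) *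
      (contractR (entry o A) a * ExteriorAlgebra.ι ℤ (eu v A)) := by
  simp [prepend]

/-- After the contraction, the star has gaps at `o` and `i`. A factor `e_{vA}` with `v ≠ o` gives
zero unless it fills the gap at `i`, so the sum over `v` in `prepend` finds the first vertex of the
path by itself. -/
theorem prepend_mul_costar {A o i : Fin n} (hoi : o < i) (hi : i < A)
    {a : ExteriorAlgebra ℤ (nil n)} (ha : contractR (entry o A) a = 0) :
    prepend A o (a * costar A i) = ExteriorAlgebra.ι ℤ (eu o i) * (a * costar A o) := by
  have key : ∀ v ∈ Finset.Ioo o A, contractR (entry o A) (costar A i)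
      * ExteriorAlgebra.ι ℤ (eu v A) = if v = i then -costar A o else 0 := by
    intro v hv
    rw [Finset.mem_Ioo] at hv
    rw [contractR_costar_mul_ι hv.1.ne']
    split_ifs with h
    · rw [h, costar_mul_ι_self hi, costar]
    · rw [costar_mul_ι_of_ne hv.2 h]; simp
  rw [prepend_apply, Finset.sum_eq_single_of_mem i (Finset.mem_Ioo.2 ⟨hoi, hi⟩)]
  · rw [contractR_mul_of_eq_zero ha, mul_assoc, key i (Finset.mem_Ioo.2 ⟨hoi, hi⟩), if_pos rfl]
    simp
  · intro v hv hvi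
    rw [contractR_mul_of_eq_zero ha, mul_assoc, key v hv, if_neg hvi]
    simp

/-- The gap is already at `o`, so this is a double contraction; it plays the role of a degenerate
simplex. -/
theorem prepend_mul_costar_self {A o : Fin n} {a : ExteriorAlgebra ℤ (nil n)}
    (ha : contractR (entry o A) a = 0) : prepend A o (a * costar A o) = 0 := by
  rw [prepend_apply, contractR_mul_of_eq_zero ha, costar, contractR_contractR]
  simp

theorem prepend_pathGen_self {A B o : Fin n} (hAB : A < B) {L : List (Fin n)}
    (hA : ∀ w ∈ o :: L, w < A) : prepend A o (pathGen A B (o :: L)) = 0 :=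
  prepend_mul_costar_self (contractR_path hAB hA)

theorem prepend_pathGen {A B o v : Fin n} (hAB : A < B) (hov : o < v) {L : List (Fin n)}
    (hA : ∀ w ∈ v :: L, w < A) :
    prepend A o (pathGen A B (v :: L)) = pathGen A B (o :: v :: L) := by
  rw [pathGen, prepend_mul_costar hov (hA v (by simp)) (contractR_path hAB hA), pathGen,
    path_cons_cons, mul_assoc]

/-- Prepending `o` is a contracting homotopy on paths with at least two vertices. -/
theorem homotopy_pathGen {A B o u v : Fin n} (ho : ∀ i, o ≤ i) (hAB : A < B) {L : List (Fin n)}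
    (hL : (u :: v :: L).Pairwise (· < ·)) (hA : ∀ w ∈ u :: v :: L, w < A) :
    boundary ℤ (nil n) (prepend A o (pathGen A B (u :: v :: L)))
      + prepend A o (boundary ℤ (nil n) (pathGen A B (u :: v :: L)))
      = pathGen A B (u :: v :: L) := by
  have hu : u < A := hA u (by simp)
  have hA' : ∀ w ∈ v :: L, w < A := fun w hw => hA w (List.mem_cons_of_mem _ hw)
  have hd := contractR_boundary_path (o := o) hAB hL hA
  rw [boundary_pathGen hAB hL hA, map_add]
  have huv : u < v := List.rel_of_pairwise_cons hL (by simp)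
  -- If the path starts in `o`, only the face without `o` contributes, and prepending `o` restores
  -- the path. Otherwise this is the usual cone computation.
  rcases (ho u).eq_or_lt with rfl | hou
  · rw [prepend_pathGen_self hAB hA, prepend_mul_costar_self hd, prepend_pathGen hAB huv hA']
    simp
  · have hL' : (o :: u :: v :: L).Pairwise (· < ·) := by
      refine List.pairwise_cons.2 ⟨fun w hw => ?_, hL⟩
      rcases List.mem_cons.1 hw with rfl | hw
      · exact hou
      · exact hou.trans (List.rel_of_pairwise_cons hL hw)
    rw [prepend_pathGen hAB hou hA, prepend_mul_costar hou hu hd,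
      prepend_pathGen hAB (hou.trans huv) hA', boundary_pathGen hAB hL' (by
        intro w hw
        rcases List.mem_cons.1 hw with rfl | hw
        · exact hou.trans hu
        · exact hA w hw), boundary_path_cons_cons (hu.trans hAB) hL']
    simp only [pathGen, neg_mul, add_mul, mul_assoc]
    abel

/-- The generator in which every vertex below `A` points to `A`, and `A` points to `B`. -/
noncomputable def apexGen (A B : Fin n) : ExteriorAlgebra ℤ (nil n) :=
  ExteriorAlgebra.ι ℤ (eu A B) * star A (below A)

/-- The star has no gap: contraction opens one at `o`, and no `e_{vA}` with `v ≠ o` can be added. -/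
theorem prepend_apexGen {A B o : Fin n} (hAB : A < B) :
    prepend A o (apexGen A B) = 0 := by
  rw [prepend_apply, apexGen, contractR_ι_mul_of_eq_zero (entry_eu_of_ne_right hAB.ne'),
    Finset.sum_eq_zero, neg_zero]
  intro v hv
  rw [Finset.mem_Ioo] at hv
  rw [mul_assoc, ← costar, costar_mul_ι_of_ne hv.2 hv.1.ne']
  simp

theorem adAction_eu_star_apex {A B : Fin n} (hAB : A < B) {S : List (Fin n)}
    (hS : ∀ i ∈ S, i < A) :
    adAction ℤ (eu A B) (star A S) = -∑ j ∈ Finset.Iio A,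
      contractR (entry j A) (star A S) * ExteriorAlgebra.ι ℤ (eu j B) := by
  induction S using List.reverseRecOn with
  | nil =>
    change adAction ℤ _ 1 = -∑ j ∈ Finset.Iio A, contractR _ 1 * _
    simp [adAction_one, contractR_one]
  | append_singleton S i ih =>
    have hi : i < A := hS i (by simp)
    have hb : ⁅eu A B, eu i A⁆ = -eu i B := by rw [← lie_skew, lie_eu_eu hi hAB]
    rw [star_concat, adAction_mul_ι, ih fun j hj => hS j (by simp [hj]), hb]
    simp only [contractR_mul_ι, sub_mul, Finset.sum_sub_distrib]
    rw [Finset.sum_eq_single_of_mem (f := fun j => (entry j A (eu i A) • star A S)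
      * ExteriorAlgebra.ι ℤ (eu j B)) i (Finset.mem_Iio.2 hi)
      (fun j _ hj => by rw [entry_eu_of_ne_left hj.symm]; simp), entry_eu_self hi]
    simp only [mul_ι_mul_ι (eu i A) (eu _ B), Finset.sum_neg_distrib, ← Finset.sum_mul]
    simp only [one_smul, map_neg, mul_neg, neg_mul, sub_neg_eq_add, neg_add]
    abel

/-- Each edge from `j` to `A` merges with the edge from `A` to `B`, which leaves the vertex `j`. The
sign comes from moving `e_{jB}` past the `A - 1` other factors, so it is the same for all `j`. -/
theorem boundary_apexGen {A B : Fin n} (hAB : A < B) :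
    boundary ℤ (nil n) (apexGen A B)
      = (-1 : ℤ) ^ ((A : ℕ) - 1) • ∑ j ∈ Finset.Iio A, pathGen A B [j] := by
  rw [apexGen, boundary_ι_mul, boundary_star (fun i hi => mem_below.1 hi), mul_zero, add_zero,
    adAction_eu_star_apex hAB (fun i hi => mem_below.1 hi), neg_neg, Finset.smul_sum]
  refine Finset.sum_congr rfl fun j hj => ?_
  rw [Finset.mem_Iio] at hj
  have hl : ((below A).erase j).length = (A : ℕ) - 1 := by
    rw [List.length_erase_of_mem (mem_below.2 hj), length_below]
  rw [← costar]
  rcases costar_eq hj with h | h <;>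
    simp [pathGen, path, h, star_mul_ι, hl]

/-! ### The augmentation -/

/-- A linear form on the exterior algebra that is `1` on the wedge of all `e_{iA}`. -/
theorem exists_form_star (A : Fin n) {S : List (Fin n)} (hS : S.Nodup) (hA : ∀ i ∈ S, i < A) :
    ∃ θ : ExteriorAlgebra ℤ (nil n) →ₗ[ℤ] ℤ, θ (star A S) = 1 := by
  induction S with
  | nil => exact ⟨ExteriorAlgebra.algebraMapInv.toLinearMap, map_one ExteriorAlgebra.algebraMapInv⟩
  | cons i S ih =>
    rw [List.nodup_cons] at hS
    obtain ⟨θ, h⟩ := ih hS.2 fun j hj => hA j (by simp [hj])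
    -- Each contraction strips the leading factor; in the end the scalar part is read off.
    refine ⟨θ ∘ₗ contractL (entry i A), ?_⟩
    rw [LinearMap.comp_apply, star_cons, contractL_ι_mul, entry_eu_self (hA i (by simp)),
      contractL_star_of_notMem hS.1, mul_zero, sub_zero, one_smul, h]

/-- The endomorphism of `nil_n` that moves the column `B` above `A` into the column `A`. -/
def foldColumn {A B : Fin n} (hAB : A < B) : nil n →ₗ[ℤ] nil n where
  toFun M := ⟨fun i j => if j = A ∧ i < A then
      (M : Matrix (Fin n) (Fin n) ℤ) i A + (M : Matrix (Fin n) (Fin n) ℤ) i B else 0, by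
    intro i j h
    refine if_neg ?_
    rintro ⟨rfl, hi⟩
    exact h.not_gt hi⟩
  map_add' M N := by
    apply Subtype.ext
    ext i j
    change (if j = A ∧ i < A then ((M : Matrix (Fin n) (Fin n) ℤ) i A
      + (N : Matrix (Fin n) (Fin n) ℤ) i A) + ((M : Matrix (Fin n) (Fin n) ℤ) i B
      + (N : Matrix (Fin n) (Fin n) ℤ) i B) else 0) = (if _ then _ else _) + (if _ then _ else _)
    split_ifs
    · ring
    · rfl
  map_smul' c M := by
    apply Subtype.ext
    ext i j
    change (if j = A ∧ i < A then c * (M : Matrix (Fin n) (Fin n) ℤ) i A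
      + c * (M : Matrix (Fin n) (Fin n) ℤ) i B else 0) = c * (if _ then _ else _)
    split_ifs
    · ring
    · ring

theorem foldColumn_eu {A B i : Fin n} (hAB : A < B) (hi : i < A) {C : Fin n}
    (hC : C = A ∨ C = B) : foldColumn hAB (eu i C) = eu i A := by
  have hiC : i < C := by rcases hC with rfl | rfl; exacts [hi, hi.trans hAB]
  apply Subtype.ext
  rw [eu_val hi]
  ext a b
  change (if b = A ∧ a < A then (eu i C : Matrix (Fin n) (Fin n) ℤ) a A
    + (eu i C : Matrix (Fin n) (Fin n) ℤ) a B else 0) = _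
  rw [eu_val hiC]
  simp only [Matrix.single_apply]
  have := hAB.ne
  rcases hC with h | h <;> rw [h] <;> by_cases h1 : i = a <;> by_cases h2 : b = A <;> grind

/-- A linear form that takes the value `1` on all generators given by one-vertex paths. -/
theorem exists_augmentation {A B : Fin n} (hAB : A < B) :
    ∃ ε : ExteriorAlgebra ℤ (nil n) →ₗ[ℤ] ℤ, ∀ j, j < A → ε (pathGen A B [j]) = 1 := by
  obtain ⟨θ, hθ⟩ := exists_form_star A (nodup_below A) fun i hi => mem_below.1 hi
  -- Folding turns `e_{jB}` into `e_{jA}`, which fills the gap at `j`. All one-vertex generators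
  -- then become the same signed full star, on which `θ` is known.
  let Φ := ExteriorAlgebra.map (foldColumn hAB)
  have hΦ : ∀ S : List (Fin n), (∀ i ∈ S, i < A) → Φ (star A S) = star A S := by
    intro S hS
    induction S with
    | nil => exact map_one _
    | cons i S ih =>
      rw [star_cons, map_mul, ih fun j hj => hS j (by simp [hj]), ExteriorAlgebra.map_apply_ι,
        foldColumn_eu hAB (hS i (by simp)) (Or.inl rfl)]
  refine ⟨(-1 : ℤ) ^ ((A : ℕ) - 1) • θ ∘ₗ Φ.toLinearMap, fun j hj => ?_⟩
  have hΦj : Φ (costar A j) = costar A j := by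
    have := hΦ _ (fun i (hi : i ∈ (below A).erase j) => lt_of_mem_erase_below hi)
    rcases costar_eq hj with h | h <;> simp [h, this]
  have hl : ((below A).erase j).length = (A : ℕ) - 1 := by
    rw [List.length_erase_of_mem (mem_below.2 hj), length_below]
  have hs : ExteriorAlgebra.ι ℤ (eu j A) * costar A j
      = (-1 : ℤ) ^ ((A : ℕ) - 1) • star A (below A) := by
    have h2 : costar A j * ExteriorAlgebra.ι ℤ (eu j A)
        = (-1 : ℤ) ^ ((A : ℕ) - 1) • (ExteriorAlgebra.ι ℤ (eu j A) * costar A j) := by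
      rcases costar_eq hj with h | h <;> simp [h, star_mul_ι, hl]
    rw [← costar_mul_ι_self hj, h2, smul_smul, ← mul_pow]; simp
  have hp : Φ (pathGen A B [j]) = (-1 : ℤ) ^ ((A : ℕ) - 1) • star A (below A) := by
    rw [← hs, pathGen, path, path, mul_one, map_mul, hΦj, ExteriorAlgebra.map_apply_ι]
    exact congrArg (fun x => ExteriorAlgebra.ι ℤ x * costar A j)
      (foldColumn_eu hAB hj (Or.inr rfl))
  rw [LinearMap.smul_apply, LinearMap.comp_apply, AlgHom.toLinearMap_apply, hp, map_smul, hθ,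
    smul_smul, ← mul_pow]
  simp

end PathWedges

/-! ### The generators span the weight space -/

section Spanning

attribute [local instance] LieRing.ofAssociativeRing

variable {n : ℕ}

theorem root_eq (s : Pos n) : root s = Pi.single s.1.2 1 - Pi.single s.1.1 1 := by
  ext i
  simp [root, Pi.single_apply, eq_comm]

/-- The weight with value `-1` below `A`, value `A - 1` at `A` and value `1` at `B`. -/
def sinkWeight (A B : Fin n) : Fin n → ℤ :=
  Pi.single B 1 + ((A : ℕ) - 1 : ℤ) • Pi.single A 1
    - ((below A).map fun i => (Pi.single i 1 : Fin n → ℤ)).sum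

theorem ι_eu_mul_mem_weightSpan {a b : Fin n} (hab : a < b) {l : Fin n → ℤ} {k : ℕ}
    {x : ExteriorAlgebra ℤ (nil n)} (hx : x ∈ weightSpan n l k) :
    ExteriorAlgebra.ι ℤ (eu a b) * x
      ∈ weightSpan n (Pi.single b 1 - Pi.single a 1 + l) (k + 1) := by
  rw [eu_of_lt hab]
  have := ι_mul_mem_weightSpan ⟨(a, b), hab⟩ hx
  rwa [root_eq] at this

theorem path_mul_mem_weightSpan {B v : Fin n} {L : List (Fin n)}
    (hL : (v :: L).Pairwise (· < ·)) (hB : ∀ w ∈ v :: L, w < B) {l : Fin n → ℤ} {k : ℕ}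
    {x : ExteriorAlgebra ℤ (nil n)} (hx : x ∈ weightSpan n l k) :
    path B (v :: L) * x
      ∈ weightSpan n (Pi.single B 1 - Pi.single v 1 + l) (L.length + k + 1) := by
  induction L generalizing v with
  | nil =>
    rw [path, path, mul_one]
    simpa using ι_eu_mul_mem_weightSpan (hB v (by simp)) hx
  | cons w L ih =>
    have := ι_eu_mul_mem_weightSpan (List.rel_of_pairwise_cons hL (by simp : w ∈ w :: L))
      (ih (List.pairwise_cons.1 hL).2 fun u hu => hB u (List.mem_cons_of_mem _ hu))
    rw [path_cons_cons, mul_assoc]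
    convert this using 2
    · abel
    · simp only [List.length_cons]; omega

theorem one_mem_weightSpan : (1 : ExteriorAlgebra ℤ (nil n)) ∈ weightSpan n 0 0 := by
  refine Submodule.subset_span ⟨Fin.elim0, ?_, by simp⟩
  ext i
  simp [weight]

theorem star_mem_weightSpan {A : Fin n} {S : List (Fin n)} (hS : ∀ i ∈ S, i < A) :
    star A S ∈ weightSpan n ((S.length : ℤ) • Pi.single A 1
      - (S.map fun i => (Pi.single i 1 : Fin n → ℤ)).sum) S.length := by
  induction S with
  | nil => simpa using! one_mem_weightSpan
  | cons i S ih =>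
    rw [star_cons]
    have := ι_eu_mul_mem_weightSpan (hS i (by simp)) (ih fun j hj => hS j (by simp [hj]))
    convert this using 2
    · simp only [List.length_cons, List.map_cons, List.sum_cons]
      push_cast
      rw [add_smul, one_smul]
      abel
    · rfl

theorem perm_cons_erase_below {A i : Fin n} (hi : i < A) :
    (below A).Perm (i :: (below A).erase i) :=
  List.perm_cons_erase (mem_below.2 hi)

theorem pathGen_mem_weightSpan {A B v : Fin n} (hAB : A < B) {L : List (Fin n)}
    (hL : (v :: L).Pairwise (· < ·)) (hA : ∀ w ∈ v :: L, w < A) :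
    pathGen A B (v :: L) ∈ weightSpan n (sinkWeight A B) (L.length + A) := by
  have hv : v < A := hA v (by simp)
  have hl : ((below A).erase v).length + 1 = (A : ℕ) := by
    rw [List.length_erase_of_mem (mem_below.2 hv), length_below]
    have : (v : ℕ) < A := hv
    omega
  have h1 : costar A v ∈ weightSpan n ((((below A).erase v).length : ℤ) • Pi.single A 1
      - (((below A).erase v).map fun i => (Pi.single i 1 : Fin n → ℤ)).sum)
      ((below A).erase v).length := by
    have := star_mem_weightSpan (fun j (hj : j ∈ (below A).erase v) => lt_of_mem_erase_below hj)
    rcases costar_eq hv with h | h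
    · rw [h]; exact this
    · rw [h]; exact neg_mem this
  have := path_mul_mem_weightSpan hL (fun w hw => (hA w hw).trans hAB) h1
  rw [pathGen]
  convert this using 2
  · rw [sinkWeight, ((perm_cons_erase_below hv).map _).sum_eq, List.map_cons, List.sum_cons, ← hl]
    push_cast
    rw [add_sub_cancel_right]
    abel
  · omega

theorem apexGen_mem_weightSpan {A B : Fin n} (hAB : A < B) :
    apexGen A B ∈ weightSpan n (sinkWeight A B) (A + 1) := by
  have := ι_eu_mul_mem_weightSpan hAB
    (star_mem_weightSpan (fun j (hj : j ∈ below A) => mem_below.1 hj))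
  rw [length_below] at this
  have h : sinkWeight A B = Pi.single B 1 - Pi.single A 1 + (((A : ℕ) : ℤ) • Pi.single A 1
      - ((below A).map fun i => (Pi.single i 1 : Fin n → ℤ)).sum) := by
    rw [sinkWeight, sub_smul, one_smul]
    abel
  rwa [h]

theorem sum_apply_map {α : Type*} (l : List α) (f : α → Fin n → ℤ) (i : Fin n) :
    (l.map f).sum i = (l.map fun s => f s i).sum := by
  induction l with
  | nil => rfl
  | cons s l ih => simp [ih]

/-- The functional `∑ i, i * f i` takes the positive value `b - a` on the weight of each `e_{ab}`.
-/
theorem eq_nil_of_sum_root_eq_zero {l : List (Pos n)} (h : (l.map root).sum = 0) : l = [] := by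
  let φ : (Fin n → ℤ) →+ ℤ :=
    { toFun := fun f => ∑ i : Fin n, (i : ℤ) * f i
      map_zero' := by simp
      map_add' := fun f g => by simp [mul_add, Finset.sum_add_distrib] }
  have hφ : ∀ s : Pos n, 0 < φ (root s) := by
    intro s
    have : φ (root s) = (s.1.2 : ℤ) - (s.1.1 : ℤ) := by
      simp [φ, root_eq, mul_sub, Finset.sum_sub_distrib, Pi.single_apply]
    have h2 : (s.1.1 : ℕ) < s.1.2 := s.2
    rw [this]; omega
  by_contra hl
  have : 0 < (l.map fun s => φ (root s)).sum := by
    refine List.sum_pos _ (fun x hx => ?_) (by simpa using hl)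
    obtain ⟨s, _, rfl⟩ := List.mem_map.1 hx
    exact hφ s
  have h2 := congrArg φ h
  rw [map_list_sum, List.map_map, map_zero] at h2
  exact this.ne' h2

/-- A wedge of matrix units whose weight is that of a single matrix unit at `(a, b)` is, up to
sign, given by a path from `a` to `b`. -/
theorem exists_path {b : Fin n} (l : List (Pos n)) (a : Fin n)
    (h : (l.map root).sum = Pi.single b 1 - Pi.single a 1) :
    (a = b ∧ l = []) ∨ ∃ L : List (Fin n), (a :: L).Pairwise (· < ·) ∧ (∀ w ∈ a :: L, w < b) ∧
      L.length + 1 = l.length ∧ (∀ w ∈ L, ∃ s ∈ l, s.1.2 = w) ∧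
      (wedgeList ℤ (l.map e) = path b (a :: L) ∨ wedgeList ℤ (l.map e) = -path b (a :: L)) := by
  induction hk : l.length generalizing l a with
  | zero =>
    left
    obtain rfl := List.length_eq_zero_iff.1 hk
    refine ⟨?_, rfl⟩
    by_contra hab
    have := congrFun h a
    simp [hab] at this
  | succ k ih =>
    by_cases hab : a = b
    · subst hab
      exact Or.inl ⟨rfl, eq_nil_of_sum_root_eq_zero (by rw [h, sub_self])⟩
    right
    -- The total weight at `a` is `-1`, so some edge leaves `a`. The path continues from its
    -- endpoint with the remaining edges.
    have hs : ∃ s ∈ l, s.1.1 = a := by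
      by_contra! hs
      have h1 := congrFun h a
      rw [sum_apply_map] at h1
      have h2 : 0 ≤ (l.map fun s => root s a).sum := by
        refine List.sum_nonneg fun x hx => ?_
        obtain ⟨s, hsl, rfl⟩ := List.mem_map.1 hx
        simp only [root, hs s hsl, if_false]
        split_ifs <;> simp
      rw [h1] at h2
      simp [hab] at h2
    obtain ⟨s, hsl, rfl⟩ := hs
    have hp := List.perm_cons_erase hsl
    have hsum : ((l.erase s).map root).sum = Pi.single b 1 - Pi.single s.1.2 1 := by
      rw [(hp.map root).sum_eq, List.map_cons, List.sum_cons, root_eq] at h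
      rw [eq_sub_of_add_eq' h]; abel
    have hlen : (l.erase s).length = k := by rw [List.length_erase_of_mem hsl, hk]; rfl
    have hw := wedgeList_perm (R := ℤ) (hp.map e)
    rw [List.map_cons, wedgeList_cons] at hw
    have he : e s = eu s.1.1 s.1.2 := (eu_of_lt s.2).symm
    rcases ih _ _ hsum hlen with ⟨hb, hnil⟩ | ⟨L, hL, hLb, hLl, hLm, hLw⟩
    · refine ⟨[], by simp, by simpa [← hb] using s.2, ?_, by simp, ?_⟩
      · rw [hnil] at hlen; simpa using hlen.symm
      · rw [hnil] at hw
        simpa [path, ← hb, ← he] using hw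
    · refine ⟨s.1.2 :: L, ?_, ?_, ?_, ?_, ?_⟩
      · refine List.pairwise_cons.2 ⟨fun w hw => ?_, hL⟩
        rcases List.mem_cons.1 hw with rfl | hw
        · exact s.2
        · exact lt_trans s.2 (List.rel_of_pairwise_cons hL hw)
      · intro w hw
        rcases List.mem_cons.1 hw with rfl | hw
        · exact lt_trans s.2 (hLb _ (by simp))
        · exact hLb w hw
      · simp [hLl]
      · intro w hw
        rcases List.mem_cons.1 hw with rfl | hw
        · exact ⟨s, hsl, rfl⟩
        · obtain ⟨t, ht, h⟩ := hLm w hw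
          exact ⟨t, List.mem_of_mem_erase ht, h⟩
      · rw [path_cons_cons, ← he]
        rcases hw with hw | hw <;> rcases hLw with h | h <;> simp [hw, h]

/-- The generators of degree `k` of the complex of weight `sinkWeight A B`. -/
def generators (A B : Fin n) (k : ℕ) : Set (ExteriorAlgebra ℤ (nil n)) :=
  {a | (∃ (v : Fin n) (L : List (Fin n)), (v :: L).Pairwise (· < ·) ∧ (∀ w ∈ v :: L, w < A) ∧
    L.length + A = k ∧ a = pathGen A B (v :: L)) ∨ (k = A + 1 ∧ a = apexGen A B)}

theorem sum_root_of_target {A : Fin n} {l : List (Pos n)} (hl : ∀ s ∈ l, s.1.2 = A) :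
    (l.map root).sum = (l.length : ℤ) • Pi.single A 1
      - ((l.map fun s => s.1.1).map fun i => (Pi.single i 1 : Fin n → ℤ)).sum := by
  induction l with
  | nil => simp
  | cons s l ih =>
    simp only [List.map_cons, List.sum_cons, List.length_cons, root_eq, hl s (by simp),
      ih fun t ht => hl t (by simp [ht])]
    push_cast
    rw [add_smul, one_smul]
    abel

/-- The edges into `A`, with sources `T`, are split off; `T` misses at most one vertex below `A`,
and what is left has the weight of a single edge, so it is a path by `exists_path`. -/
theorem wedgeList_mem_span_generators {A B : Fin n} (hAB : (B : ℕ) = A + 1) {l : List (Pos n)}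
    (hl : l.Nodup) (h : (l.map root).sum = sinkWeight A B) :
    wedgeList ℤ (l.map e) ∈ Submodule.span ℤ (generators A B l.length) := by
  have hAB' : A < B := by rw [Fin.lt_def]; omega
  let l₁ := l.filter fun s => s.1.2 = A
  let l₂ := l.filter fun s => !decide (s.1.2 = A)
  have hp : l.Perm (l₂ ++ l₁) := (List.perm_append_comm.trans (List.filter_append_perm _ l)).symm
  have h₁ : ∀ s ∈ l₁, s.1.2 = A := fun s hs => by simpa using List.of_mem_filter hs
  have h₂ : ∀ s ∈ l₂, s.1.2 ≠ A := fun s hs => by simpa using List.of_mem_filter hs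
  let T := l₁.map fun s => s.1.1
  have hT : T.Nodup := (hl.filter _).map_on fun s hs t ht hst =>
    Subtype.ext (Prod.ext hst ((h₁ s hs).trans (h₁ t ht).symm))
  have hTA : ∀ i ∈ T, i < A := by
    intro i hi
    obtain ⟨s, hs, rfl⟩ := List.mem_map.1 hi
    exact h₁ s hs ▸ s.2
  have he₁ : l₁.map e = T.map fun i => eu i A := by
    rw [List.map_map]
    refine List.map_congr_left fun s hs => ?_
    rw [Function.comp_apply, ← h₁ s hs, eu_of_lt s.2]
  have hr₁ : (l₁.map root).sum = (T.length : ℤ) • Pi.single A 1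
      - (T.map fun i => (Pi.single i 1 : Fin n → ℤ)).sum := by
    rw [sum_root_of_target h₁, List.length_map]
  have hr : (l₂.map root).sum = sinkWeight A B - ((T.length : ℤ) • Pi.single A 1
      - (T.map fun i => (Pi.single i 1 : Fin n → ℤ)).sum) := by
    rw [← h, (hp.map root).sum_eq, List.map_append, List.sum_append, hr₁, add_sub_cancel_right]
  have hlen : l.length = l₂.length + T.length := by
    rw [hp.length_eq, List.length_append, List.length_map]
  have hw : wedgeList ℤ (l.map e) = wedgeList ℤ (l₂.map e) * star A T ∨
      wedgeList ℤ (l.map e) = -(wedgeList ℤ (l₂.map e) * star A T) := by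
    have := wedgeList_perm (R := ℤ) (hp.map e)
    rwa [List.map_append, wedgeList_append, he₁] at this
  have hsub : T.Subperm (below A) := List.subperm_of_subset hT fun i hi => mem_below.2 (hTA i hi)
  by_cases hall : ∀ i < A, i ∈ T
  · have hperm : T.Perm (below A) := (List.perm_ext_iff_of_nodup hT (nodup_below A)).2
      fun i => ⟨fun hi => mem_below.2 (hTA i hi), fun hi => hall i (mem_below.1 hi)⟩
    have hTl : T.length = A := by rw [hperm.length_eq, length_below]
    have hs : star A T = star A (below A) ∨ star A T = -star A (below A) :=
      wedgeList_perm (hperm.map _)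
    have hr' : (l₂.map root).sum = Pi.single B 1 - Pi.single A 1 := by
      rw [hr, sinkWeight, hTl, (hperm.map _).sum_eq, sub_smul, one_smul]; abel
    rcases exists_path l₂ A hr' with ⟨h, _⟩ | ⟨L, hL, hLB, hLl, _, hLw⟩
    · exact absurd h hAB'.ne
    -- No vertex lies strictly between `A` and `B = A + 1`, so the path is a single edge.
    have hnil : L = [] := List.eq_nil_iff_forall_not_mem.2 fun w hw => by
      have h1 : A < w := List.rel_of_pairwise_cons hL hw
      have h2 : w < B := hLB w (by simp [hw])
      rw [Fin.lt_def] at h1 h2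
      omega
    subst hnil
    have hg : apexGen A B ∈ Submodule.span ℤ (generators A B l.length) :=
      Submodule.subset_span (Or.inr ⟨by simp at hLl; omega, rfl⟩)
    have hg' : path B [A] * star A (below A) ∈ Submodule.span ℤ (generators A B l.length) := by
      simpa [path, apexGen] using hg
    have hg'' := neg_mem hg'
    rcases hw with hw | hw <;> rcases hLw with hLw | hLw <;> rcases hs with hs | hs <;>
      simpa [hw, hLw, hs]
  · push Not at hall
    obtain ⟨i, hi, hiT⟩ := hall
    -- The weight at `A` is `A - 1`, and edges not ending in `A` contribute nothing positive there.
    have hTl₁ : (A : ℤ) - 1 ≤ T.length := by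
      have h1 := congrFun hr A
      have h2 : (l₂.map fun s => root s A).sum ≤ 0 := by
        refine (List.sum_le_card_nsmul _ 0 fun x hx => ?_).trans (by simp)
        obtain ⟨s, hs, rfl⟩ := List.mem_map.1 hx
        simp only [root, h₂ s hs, if_false]
        split_ifs <;> simp
      have h3 : ∀ S : List (Fin n), (∀ i ∈ S, i < A) →
          (S.map fun i => (Pi.single i 1 : Fin n → ℤ) A).sum = 0 := by
        intro S hS
        refine List.sum_eq_zero fun x hx => ?_
        obtain ⟨j, hj, rfl⟩ := List.mem_map.1 hx
        simp [(hS j hj).ne']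
      rw [sum_apply_map] at h1
      rw [h1] at h2
      simp only [sinkWeight, Pi.sub_apply, Pi.add_apply, Pi.smul_apply, Pi.single_eq_same,
        sum_apply_map, h3 T hTA, h3 _ (fun i hi => mem_below.1 hi),
        Pi.single_eq_of_ne hAB'.ne] at h2
      simpa using h2
    have hsub' : (i :: T).Subperm (below A) :=
      List.subperm_of_subset (List.nodup_cons.2 ⟨hiT, hT⟩) fun j hj => by
        rcases List.mem_cons.1 hj with rfl | hj
        exacts [mem_below.2 hi, mem_below.2 (hTA j hj)]
    have hperm' : (i :: T).Perm (below A) := hsub'.perm_of_length_le (by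
      rw [length_below, List.length_cons]; omega)
    have hperm : T.Perm ((below A).erase i) :=
      (hperm'.trans (perm_cons_erase_below hi)).cons_inv
    have hTl : T.length + 1 = A := by rw [← length_below A, ← hperm'.length_eq, List.length_cons]
    have hs : star A T = costar A i ∨ star A T = -costar A i := by
      have : star A T = star A ((below A).erase i) ∨ star A T = -star A ((below A).erase i) :=
        wedgeList_perm (hperm.map _)
      rcases this with h | h <;> rcases costar_eq hi with h' | h' <;> simp [h, h']
    have hr' : (l₂.map root).sum = Pi.single B 1 - Pi.single i 1 := by
      rw [hr, sinkWeight, ← (hperm'.map _).sum_eq, List.map_cons, List.sum_cons, ← hTl]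
      push_cast
      rw [add_sub_cancel_right]
      abel
    rcases exists_path l₂ i hr' with ⟨h, _⟩ | ⟨L, hL, hLB, hLl, hLm, hLw⟩
    · exact absurd h (hi.trans hAB').ne
    -- The vertices after `i` are endpoints of edges in `l₂`, hence different from `A`, and they lie
    -- below `B = A + 1`.
    have hLA : ∀ w ∈ i :: L, w < A := by
      intro w hw
      rcases List.mem_cons.1 hw with rfl | hw'
      · exact hi
      · obtain ⟨s, hs, rfl⟩ := hLm w hw'
        have h1 := h₂ s hs
        have h2 := hLB _ hw
        rw [Ne, Fin.ext_iff] at h1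
        rw [Fin.lt_def] at h2 ⊢
        omega
    have hg : path B (i :: L) * costar A i ∈ Submodule.span ℤ (generators A B l.length) :=
      Submodule.subset_span (Or.inl ⟨i, L, hL, hLA, by omega, rfl⟩)
    have hg' := neg_mem hg
    rcases hw with hw | hw <;> rcases hLw with hLw | hLw <;> rcases hs with hs | hs <;>
      simpa [hw, hLw, hs]

theorem weight_eq_sum {k : ℕ} (p : Fin k → Pos n) :
    weight p = ((List.ofFn p).map root).sum := by
  induction k with
  | zero => ext i; simp [weight]
  | succ k ih => rw [weight_succ, ih, List.ofFn_succ, List.map_cons, List.sum_cons]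

/-- Linear independence of the generators is not needed: the homotopy and the augmentation are
linear maps on the whole exterior algebra, so identities may be checked on a spanning set. -/
theorem weightSpan_sinkWeight {A B : Fin n} (hAB : (B : ℕ) = A + 1) (k : ℕ) :
    weightSpan n (sinkWeight A B) k = Submodule.span ℤ (generators A B k) := by
  have hAB' : A < B := by rw [Fin.lt_def]; omega
  apply le_antisymm
  · refine Submodule.span_le.2 ?_
    rintro _ ⟨p, hp, rfl⟩
    by_cases hi : Function.Injective p
    · have := wedgeList_mem_span_generators hAB (List.nodup_ofFn.2 hi) (by rw [← weight_eq_sum, hp])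
      rw [List.length_ofFn, List.map_ofFn] at this
      rw [ιMulti_eq_wedgeList]
      exact this
    · rw [AlternatingMap.map_eq_zero_of_not_injective]
      · exact zero_mem _
      · exact fun h => hi fun a b hab => h (by simp [hab])
  · refine Submodule.span_le.2 ?_
    rintro _ (⟨v, L, hL, hA, rfl, rfl⟩ | ⟨rfl, rfl⟩)
    · exact pathGen_mem_weightSpan hAB' hL hA
    · exact apexGen_mem_weightSpan hAB'

/-- Positions in the weight vector start at `1`, indices at `0`: the entries `2` and `q + 1` after
the first block sit at `A = q` and `B = q + 1`. -/
theorem unmodify_torsionWeight {q : ℕ} (hn : q + 2 ≤ n) :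
    unmodify (torsionWeight q n) = sinkWeight ⟨q, by omega⟩ ⟨q + 1, by omega⟩ := by
  ext i
  have h : ((below (⟨q, by omega⟩ : Fin n)).map fun j => (Pi.single j 1 : Fin n → ℤ) i).sum
      = if (i : ℕ) < q then 1 else 0 := by
    have h1 := List.sum_toFinset (fun j => (Pi.single j 1 : Fin n → ℤ) i)
      (nodup_below (⟨q, by omega⟩ : Fin n))
    rw [← h1]
    simp [Pi.single_apply, mem_below, Fin.lt_def]
  simp only [sinkWeight, Pi.sub_apply, Pi.add_apply, Pi.smul_apply, sum_apply_map, unmodify,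
    torsionWeight, Pi.single_apply, Fin.ext_iff, smul_eq_mul]
  split_ifs <;> grind

end Spanning

/-! ### Computing homology of subcomplexes by elements -/

section Homology

variable {R : Type u} {L : Type v} [CommRing R] [LieRing L] [LieAlgebra R L]
  {C : ℕ → Submodule R (ExteriorAlgebra R L)}
  (hC : ∀ k, ∀ a ∈ C (k + 1), boundary R L a ∈ C k)

theorem complexOf_d_apply (k : ℕ) (a : C (k + 1)) :
    ((complexOf C hC).d (k + 1) k a : (complexOf C hC).X k)
      = (⟨boundary R L a, hC k a a.2⟩ : C k) := by
  have : (complexOf C hC).d (k + 1) k = ModuleCat.ofHom ((boundary R L).restrict (hC k)) :=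
    ChainComplex.of_d (fun k => ModuleCat.of R (C k))
      (fun k => ModuleCat.ofHom ((boundary R L).restrict (hC k))) k
  rw [this]
  rfl

theorem complexOf_homology_subsingleton_of_eq_bot {k : ℕ} (h : C k = ⊥) :
    Subsingleton ((complexOf C hC).homology k) := by
  refine ModuleCat.subsingleton_of_isZero (HomologicalComplex.ExactAt.isZero_homology
    (HomologicalComplex.ExactAt.of_isZero ?_))
  have : Subsingleton (C k) := by rw [h]; infer_instance
  exact ModuleCat.isZero_of_subsingleton (ModuleCat.of R (C k))

theorem complexOf_homology_subsingleton {k : ℕ}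
    (h : ∀ a ∈ C (k + 1), boundary R L a = 0 → ∃ b ∈ C (k + 2), boundary R L b = a) :
    Subsingleton ((complexOf C hC).homology (k + 1)) := by
  refine ModuleCat.subsingleton_of_isZero (HomologicalComplex.ExactAt.isZero_homology ?_)
  rw [HomologicalComplex.exactAt_iff' _ (k + 2) (k + 1) k (by simp) (by simp),
    ShortComplex.moduleCat_exact_iff]
  intro (a : C (k + 1)) ha
  have ha' : boundary R L a = 0 :=
    congrArg Subtype.val ((complexOf_d_apply hC k a).symm.trans ha)
  obtain ⟨b, hb, hba⟩ := h a a.2 ha'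
  exact ⟨(⟨b, hb⟩ : C (k + 2)), (complexOf_d_apply hC (k + 1) ⟨b, hb⟩).trans (Subtype.ext hba)⟩

/-- Homology computed by a linear map that is onto on cycles and whose kernel on cycles consists of
the boundaries. -/
theorem nonempty_complexOf_homology_equiv {k : ℕ} {M : Type*} [AddCommGroup M] [Module R M]
    (φ : ExteriorAlgebra R L →ₗ[R] M)
    (hsurj : ∀ m, ∃ a ∈ C (k + 1), boundary R L a = 0 ∧ φ a = m)
    (hbdry : ∀ b ∈ C (k + 2), φ (boundary R L b) = 0)
    (hker : ∀ a ∈ C (k + 1), boundary R L a = 0 → φ a = 0 →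
      ∃ b ∈ C (k + 2), boundary R L b = a) :
    Nonempty ((complexOf C hC).homology (k + 1) ≃+ M) := by
  let K := complexOf C hC
  let S := K.sc' (k + 2) (k + 1) k
  let incl : LinearMap.ker S.g.hom →ₗ[R] ExteriorAlgebra R L :=
    (C (k + 1)).subtype ∘ₗ (LinearMap.ker S.g.hom).subtype
  let ψ : LinearMap.ker S.g.hom →ₗ[R] M := φ ∘ₗ incl
  have hψ : Function.Surjective ψ := by
    intro m
    obtain ⟨a, ha, hda, hm⟩ := hsurj m
    exact ⟨⟨(⟨a, ha⟩ : C (k + 1)), (complexOf_d_apply hC k ⟨a, ha⟩).trans (Subtype.ext hda)⟩, hm⟩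
  have hrange : LinearMap.range S.moduleCatToCycles = LinearMap.ker ψ := by
    apply le_antisymm
    · rintro _ ⟨b, rfl⟩
      obtain ⟨b, hb⟩ : C (k + 2) := b
      have h := complexOf_d_apply hC (k + 1) ⟨b, hb⟩
      exact (congrArg (fun a : C (k + 1) => φ a) h).trans (hbdry b hb)
    · rintro ⟨(a : C (k + 1)), ha⟩ hφ
      have ha' : boundary R L (a : ExteriorAlgebra R L) = 0 :=
        congrArg Subtype.val ((complexOf_d_apply hC k a).symm.trans ha)
      obtain ⟨b, hb, hba⟩ := hker a a.2 ha' hφ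
      exact ⟨(⟨b, hb⟩ : C (k + 2)), Subtype.ext
        ((complexOf_d_apply hC (k + 1) ⟨b, hb⟩).trans (Subtype.ext hba))⟩
  have iso : K.homology (k + 1) ≅ S.moduleCatLeftHomologyData.H :=
    ShortComplex.homologyMapIso (K.isoSc' (k + 2) (k + 1) k (by simp) (by simp)) ≪≫
      S.moduleCatHomologyIso
  exact ⟨iso.toLinearEquiv.toAddEquiv.trans
    ((Submodule.quotEquivOfEq _ _ hrange).trans (ψ.quotKerEquivOfSurjective hψ)).toAddEquiv⟩

/-- A split monomorphism of modules exhibits its source as a direct summand. -/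
theorem nonempty_equiv_prod_of_isSplitMono {X Y : ModuleCat.{u} R} (f : X ⟶ Y) [IsSplitMono f] :
    ∃ A : ModuleCat.{u} R, Nonempty (Y ≃+ X × A) := by
  let g := retraction f
  have hgf : ∀ x, g.hom (f.hom x) = x := fun x =>
    congrArg (fun h : X ⟶ X => h.hom x) (IsSplitMono.id f)
  refine ⟨ModuleCat.of R (LinearMap.ker g.hom), ⟨?_⟩⟩
  exact
    { toFun := fun y => (g.hom y, ⟨y - f.hom (g.hom y), by
        rw [LinearMap.mem_ker, map_sub, hgf, sub_self]⟩)
      invFun := fun p => f.hom p.1 + (p.2 : LinearMap.ker g.hom)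
      left_inv := fun y => by simp
      right_inv := fun p => by
        have h : g.hom (p.2 : LinearMap.ker g.hom) = 0 := (p.2 : LinearMap.ker g.hom).2
        refine Prod.ext ?_ (Subtype.ext ?_)
        · simp only [map_add, hgf, h, add_zero]
        · simp only [map_add, hgf, h, add_zero, add_sub_cancel_left]
      map_add' := fun x y => by
        refine Prod.ext ?_ (Subtype.ext ?_)
        · simp
        · simp only [map_add]
          change _ = (x - f.hom (g.hom x)) + (y - f.hom (g.hom y))
          abel }

end Homology

/-! ### The weight grading and the splitting of the inclusion -/

section WeightProjection

attribute [local instance] LieRing.ofAssociativeRing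

variable {n : ℕ}

theorem e_eq_eu (s : Pos n) : e s = eu s.1.1 s.1.2 := (eu_of_lt s.2).symm

theorem entry_e_self (s : Pos n) : entry s.1.1 s.1.2 (e s) = 1 := by
  rw [e_eq_eu, entry_eu_self s.2]

theorem entry_e_of_ne {s t : Pos n} (h : s ≠ t) : entry t.1.1 t.1.2 (e s) = 0 := by
  rw [e_eq_eu]
  by_cases h1 : s.1.1 = t.1.1
  · exact entry_eu_of_ne_right fun h2 => h (Subtype.ext (Prod.ext h1 h2))
  · exact entry_eu_of_ne_left h1

theorem eq_sum_entry_smul_e (x : nil n) : x = ∑ s : Pos n, entry s.1.1 s.1.2 x • e s := by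
  have key : ∀ t : Pos n,
      entry t.1.1 t.1.2 (∑ s : Pos n, entry s.1.1 s.1.2 x • e s) = entry t.1.1 t.1.2 x := by
    intro t
    rw [map_sum, Finset.sum_eq_single t]
    · rw [map_smul, entry_e_self, smul_eq_mul, mul_one]
    · intro s _ hs
      rw [map_smul, entry_e_of_ne hs, smul_zero]
    · simp
  apply Subtype.ext
  ext i j
  by_cases h : i < j
  · exact (key ⟨(i, j), h⟩).symm
  · rw [x.2 i j (not_lt.1 h)]
    exact ((∑ s : Pos n, entry s.1.1 s.1.2 x • e s).2 i j (not_lt.1 h)).symm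

/-- Supplies the square-zero relation that lets `gradedι` extend to the exterior algebra. -/
theorem sum_mul_sum_eq_zero {A ι : Type*} [Ring A] (s : Finset ι) (f : ι → A)
    (h : ∀ i, f i * f i = 0) (h' : ∀ i j, f i * f j + f j * f i = 0) :
    (∑ i ∈ s, f i) * ∑ i ∈ s, f i = 0 := by
  classical
  induction s using Finset.induction_on with
  | empty => simp
  | insert i s hi ih =>
    have hs : f i * ∑ j ∈ s, f j + (∑ j ∈ s, f j) * f i = 0 := by
      rw [Finset.mul_sum, Finset.sum_mul, ← Finset.sum_add_distrib]
      exact Finset.sum_eq_zero fun j _ => h' i j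
    rw [Finset.sum_insert hi, add_mul, mul_add, mul_add, h, ih, zero_add, add_zero, hs]

/-- The linear map from `nil_n` to the group algebra of the weight lattice over the exterior
algebra that records the weights of matrix units. -/
noncomputable def gradedι (n : ℕ) :
    nil n →ₗ[ℤ] AddMonoidAlgebra (ExteriorAlgebra ℤ (nil n)) (Fin n → ℤ) :=
  ∑ s : Pos n, (entry s.1.1 s.1.2).smulRight
    (AddMonoidAlgebra.single (root s) (ExteriorAlgebra.ι ℤ (e s)))

theorem gradedι_apply (x : nil n) : gradedι n x = ∑ s : Pos n, entry s.1.1 s.1.2 x •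
    AddMonoidAlgebra.single (root s) (ExteriorAlgebra.ι ℤ (e s)) := by
  simp [gradedι]

theorem gradedι_e (s : Pos n) :
    gradedι n (e s) = AddMonoidAlgebra.single (root s) (ExteriorAlgebra.ι ℤ (e s)) := by
  rw [gradedι_apply, Finset.sum_eq_single s]
  · rw [entry_e_self, one_smul]
  · intro t _ ht
    rw [entry_e_of_ne ht.symm, zero_smul]
  · simp

theorem gradedι_mul_self (x : nil n) : gradedι n x * gradedι n x = 0 := by
  rw [gradedι_apply]
  refine sum_mul_sum_eq_zero _ _ (fun s => ?_) fun s t => ?_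
  · rw [smul_mul_smul_comm, AddMonoidAlgebra.single_mul_single, ExteriorAlgebra.ι_sq_zero,
      AddMonoidAlgebra.single_zero, smul_zero]
  · rw [smul_mul_smul_comm, smul_mul_smul_comm, AddMonoidAlgebra.single_mul_single,
      AddMonoidAlgebra.single_mul_single, mul_comm (entry t.1.1 t.1.2 x), add_comm (root t),
      ← smul_add, ← AddMonoidAlgebra.single_add, ExteriorAlgebra.ι_add_mul_swap,
      AddMonoidAlgebra.single_zero, smul_zero]

/-- The algebra map that records the weights of wedges of matrix units. -/
noncomputable def gradedHom (n : ℕ) : ExteriorAlgebra ℤ (nil n) →ₐ[ℤ]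
    AddMonoidAlgebra (ExteriorAlgebra ℤ (nil n)) (Fin n → ℤ) :=
  ExteriorAlgebra.lift ℤ ⟨gradedι n, gradedι_mul_self⟩

/-- Exponents in the group algebra add up under multiplication, so a wedge is tagged with its total
weight; its coefficient at `l` then gives the weight projection. -/
theorem gradedHom_wedgeList (l : List (Pos n)) :
    gradedHom n (wedgeList ℤ (l.map e))
      = AddMonoidAlgebra.single (l.map root).sum (wedgeList ℤ (l.map e)) := by
  induction l with
  | nil => simp [AddMonoidAlgebra.one_def]
  | cons s l ih =>
    simp only [List.map_cons, wedgeList_cons, map_mul, ih, List.sum_cons]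
    rw [← AddMonoidAlgebra.single_mul_single, ← gradedι_e]
    congr 1
    exact ExteriorAlgebra.lift_ι_apply ..

/-- The projection of the exterior algebra onto its part of weight `l`. -/
noncomputable def weightProj (l : Fin n → ℤ) :
    ExteriorAlgebra ℤ (nil n) →ₗ[ℤ] ExteriorAlgebra ℤ (nil n) where
  toFun a := (gradedHom n a).coeff l
  map_add' a b := by simp
  map_smul' c a := by rw [map_smul, AddMonoidAlgebra.coeff_smul]; rfl

theorem weightProj_of_mem {l l' : Fin n → ℤ} {k : ℕ} {a : ExteriorAlgebra ℤ (nil n)}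
    (ha : a ∈ weightSpan n l' k) : weightProj l a = if l' = l then a else 0 := by
  induction ha using Submodule.span_induction with
  | zero => simp
  | add a b _ _ ha hb => rw [map_add, ha, hb]; split_ifs <;> simp
  | smul c a _ ha => rw [map_smul, ha]; split_ifs <;> simp
  | mem a ha =>
    obtain ⟨p, rfl, rfl⟩ := ha
    have h : ExteriorAlgebra.ιMulti ℤ k (fun m => e (p m))
        = wedgeList ℤ ((List.ofFn p).map e) := by
      rw [ιMulti_eq_wedgeList, List.map_ofFn]; rfl
    change (gradedHom n _).coeff l = _
    rw [h, gradedHom_wedgeList, weight_eq_sum, AddMonoidAlgebra.coeff_single,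
      Finsupp.single_apply]

theorem weightProj_eq_self {l : Fin n → ℤ} {k : ℕ} {a : ExteriorAlgebra ℤ (nil n)}
    (ha : a ∈ weightSpan n l k) : weightProj l a = a := by
  rw [weightProj_of_mem ha, if_pos rfl]

theorem exteriorPower_le_iSup_weightSpan (n k : ℕ) :
    ⋀[ℤ]^k (nil n) ≤ ⨆ l, weightSpan n l k := by
  induction k with
  | zero =>
    rw [ExteriorAlgebra.exteriorPower, pow_zero, Submodule.one_le]
    exact le_iSup (fun l => weightSpan n l 0) 0 one_mem_weightSpan
  | succ k ih =>
    rw [ExteriorAlgebra.exteriorPower, pow_succ', Submodule.mul_le]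
    rintro _ ⟨x, rfl⟩ a ha
    replace ha := ih ha
    induction ha using Submodule.iSup_induction' with
    | mem l a ha =>
      rw [eq_sum_entry_smul_e x, map_sum, Finset.sum_mul]
      refine sum_mem fun s _ => ?_
      rw [map_smul, smul_mul_assoc]
      exact Submodule.smul_mem _ _
        (le_iSup (fun l => weightSpan n l (k + 1)) (root s + l) (ι_mul_mem_weightSpan s ha))
    | zero => simp
    | add a b _ _ ha hb => rw [mul_add]; exact add_mem ha hb

theorem weightProj_mem {l : Fin n → ℤ} {k : ℕ} {a : ExteriorAlgebra ℤ (nil n)}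
    (ha : a ∈ ⋀[ℤ]^k (nil n)) : weightProj l a ∈ weightSpan n l k := by
  replace ha := exteriorPower_le_iSup_weightSpan n k ha
  induction ha using Submodule.iSup_induction' with
  | mem l' a ha =>
    rw [weightProj_of_mem ha]
    split_ifs with h
    · rwa [← h]
    · exact zero_mem _
  | zero => simp
  | add a b _ _ ha hb => rw [map_add]; exact add_mem ha hb

/-- The boundary preserves weights, so it suffices to compare both sides on each weight space. -/
theorem weightProj_boundary {l : Fin n → ℤ} {k : ℕ} {a : ExteriorAlgebra ℤ (nil n)}
    (ha : a ∈ ⋀[ℤ]^(k + 1) (nil n)) :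
    weightProj l (boundary ℤ (nil n) a) = boundary ℤ (nil n) (weightProj l a) := by
  replace ha := exteriorPower_le_iSup_weightSpan n (k + 1) ha
  induction ha using Submodule.iSup_induction' with
  | mem l' a ha =>
    rw [weightProj_of_mem ha, weightProj_of_mem (boundary_mem_weightSpan l' k a ha)]
    split_ifs <;> simp
  | zero => simp
  | add a b _ _ ha hb => simp only [map_add, ha, hb]

/-- The weight projection as a map of chain complexes. -/
noncomputable def bracketProj (w : Fin n → ℤ) : chevalleyEilenberg ℤ (nil n) ⟶ bracket w :=
  ChainComplex.ofHom (X := chevalleyEilenberg ℤ (nil n)) (Y := bracket w)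
    (fun _ => ModuleCat.ofHom
      ((weightProj (unmodify w)).restrict fun _ ha => weightProj_mem ha))
    (fun k => by
      refine ModuleCat.hom_ext (LinearMap.ext fun a : ⋀[ℤ]^(k + 1) (nil n) => ?_)
      have h1 := complexOf_d_apply (C := fun k => ⋀[ℤ]^k (nil n)) boundary_mem_exteriorPower k a
      have h2 := complexOf_d_apply (boundary_mem_weightSpan (unmodify w)) k
        ⟨weightProj (unmodify w) a, weightProj_mem a.2⟩
      refine h2.trans (Eq.trans ?_ (congrArg ((weightProj (unmodify w)).restrict
        fun _ ha => weightProj_mem (k := k) ha) h1).symm)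
      exact Subtype.ext (weightProj_boundary a.2).symm)

theorem isSplitMono_bracketIncl (w : Fin n → ℤ) : IsSplitMono (bracketIncl w) :=
  ⟨⟨bracketProj w, by
    ext k a
    exact Subtype.ext (weightProj_eq_self (a : weightSpan n (unmodify w) k).2)⟩⟩

end WeightProjection

/-! ### Exactness above degree `A` and the class in degree `A` -/

section Torsion

attribute [local instance] LieRing.ofAssociativeRing

variable {n : ℕ} {A B : Fin n}

theorem generators_eq_empty {k : ℕ} (hk : k < A) : generators A B k = ∅ := by
  refine Set.eq_empty_of_forall_notMem ?_
  rintro a (⟨v, L, _, _, h, _⟩ | ⟨h, _⟩) <;> omega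

theorem generators_self {a : ExteriorAlgebra ℤ (nil n)} (ha : a ∈ generators A B A) :
    ∃ v < A, a = pathGen A B [v] := by
  rcases ha with ⟨v, L, _, hA, h, rfl⟩ | ⟨h, _⟩
  · obtain rfl : L = [] := List.length_eq_zero_iff.1 (by omega)
    exact ⟨v, hA v (by simp), rfl⟩
  · omega

theorem prepend_mem_weightSpan {o : Fin n} (ho : ∀ i, o ≤ i) (hAB : (B : ℕ) = A + 1) {k : ℕ}
    {a : ExteriorAlgebra ℤ (nil n)} (ha : a ∈ weightSpan n (sinkWeight A B) k) :
    prepend A o a ∈ weightSpan n (sinkWeight A B) (k + 1) := by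
  have hAB' : A < B := by rw [Fin.lt_def]; omega
  rw [weightSpan_sinkWeight hAB] at ha
  induction ha using Submodule.span_induction with
  | zero => simp
  | add a b _ _ ha hb => rw [map_add]; exact add_mem ha hb
  | smul c a _ ha => rw [map_smul]; exact Submodule.smul_mem _ c ha
  | mem a ha =>
    rcases ha with ⟨v, L, hL, hA, rfl, rfl⟩ | ⟨rfl, rfl⟩
    · rcases (ho v).eq_or_lt with rfl | hov
      · rw [prepend_pathGen_self hAB' hA]; exact zero_mem _
      · rw [prepend_pathGen hAB' hov hA]
        have hmem : ∀ w ∈ o :: v :: L, w < A := fun w hw => by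
          rcases List.mem_cons.1 hw with rfl | hw
          exacts [hov.trans (hA v (by simp)), hA w hw]
        have := pathGen_mem_weightSpan hAB' (List.pairwise_cons.2 ⟨fun w hw => by
          rcases List.mem_cons.1 hw with rfl | hw
          exacts [hov, hov.trans (List.rel_of_pairwise_cons hL hw)], hL⟩) hmem
        rwa [List.length_cons, add_right_comm] at this
    · rw [prepend_apexGen hAB']; exact zero_mem _

/-- In degrees above `A`, the homotopy formula holds up to a multiple of the apex generator, which
is present in degree `A + 1` only. -/
theorem exists_homotopy {o : Fin n} (ho : ∀ i, o ≤ i) (hAB : (B : ℕ) = A + 1) {k : ℕ}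
    (hk : (A : ℕ) < k) {a : ExteriorAlgebra ℤ (nil n)}
    (ha : a ∈ weightSpan n (sinkWeight A B) k) :
    ∃ c : ℤ, (k ≠ A + 1 → c = 0) ∧
      boundary ℤ (nil n) (prepend A o (a - c • apexGen A B))
        + prepend A o (boundary ℤ (nil n) (a - c • apexGen A B)) = a - c • apexGen A B := by
  have hAB' : A < B := by rw [Fin.lt_def]; omega
  rw [weightSpan_sinkWeight hAB] at ha
  induction ha using Submodule.span_induction with
  | zero => exact ⟨0, by simp⟩
  | add a b _ _ ha hb =>
    obtain ⟨c, hc, h⟩ := ha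
    obtain ⟨d, hd, h'⟩ := hb
    refine ⟨c + d, fun hk => by rw [hc hk, hd hk, add_zero], ?_⟩
    have : a + b - (c + d) • apexGen A B = (a - c • apexGen A B) + (b - d • apexGen A B) := by
      rw [add_smul]; abel
    rw [this]
    simp only [map_add (prepend A o), map_add (boundary ℤ (nil n))]
    rw [add_add_add_comm, h, h']
  | smul m a _ ha =>
    obtain ⟨c, hc, h⟩ := ha
    refine ⟨m * c, fun hk => by rw [hc hk, mul_zero], ?_⟩
    rw [mul_smul, ← smul_sub, map_smul, map_smul, map_smul, map_smul, ← smul_add, h]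
  | mem a ha =>
    rcases ha with ⟨v, L, hL, hA, rfl, rfl⟩ | ⟨rfl, rfl⟩
    · refine ⟨0, fun _ => rfl, ?_⟩
      cases L with
      | nil => simp at hk
      | cons w L => rw [zero_smul, sub_zero, homotopy_pathGen ho hAB' hL hA]
    -- The apex is cancelled entirely, because `prepend` kills it and the cone formula does not
    -- cover it.
    · exact ⟨1, fun h => absurd rfl h, by simp⟩

theorem boundary_pathGen_pair (hAB : A < B) {u v : Fin n} (huv : u < v) (hv : v < A) :
    boundary ℤ (nil n) (pathGen A B [u, v]) = pathGen A B [v] - pathGen A B [u] := by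
  have hL : [u, v].Pairwise (· < ·) := by simp [huv]
  have hA : ∀ w ∈ [u, v], w < A := by simp [huv.trans hv, hv]
  rw [boundary_pathGen hAB hL hA, boundary_path_cons_cons (hv.trans hAB) hL,
    boundary_path_singleton, mul_zero, add_zero, neg_mul, pathGen, pathGen]
  abel

/-- In the bottom degree the cone formula acquires a correction: the edge from `o` to `v` has
boundary `[v] - [o]`. -/
theorem boundary_prepend_self {o : Fin n} (ho : ∀ i, o ≤ i) (hAB : (B : ℕ) = A + 1)
    {ε : ExteriorAlgebra ℤ (nil n) →ₗ[ℤ] ℤ} (hε : ∀ j, j < A → ε (pathGen A B [j]) = 1)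
    {a : ExteriorAlgebra ℤ (nil n)} (ha : a ∈ weightSpan n (sinkWeight A B) A) :
    boundary ℤ (nil n) (prepend A o a) = a - ε a • pathGen A B [o] := by
  have hAB' : A < B := by rw [Fin.lt_def]; omega
  rw [weightSpan_sinkWeight hAB] at ha
  induction ha using Submodule.span_induction with
  | zero => simp
  | add a b _ _ ha hb => simp only [map_add, ha, hb, add_smul]; abel
  | smul c a _ ha => simp only [map_smul, ha, smul_sub, smul_assoc]
  | mem a ha =>
    obtain ⟨v, hv, rfl⟩ := generators_self ha
    rw [hε v hv, one_smul]
    rcases (ho v).eq_or_lt with rfl | hov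
    · rw [prepend_pathGen_self hAB' (by simpa using hv), map_zero, sub_self]
    · rw [prepend_pathGen hAB' hov (by simpa using hv), boundary_pathGen_pair hAB' hov hv]

theorem augmentation_boundary_apexGen (hAB : A < B) {ε : ExteriorAlgebra ℤ (nil n) →ₗ[ℤ] ℤ}
    (hε : ∀ j, j < A → ε (pathGen A B [j]) = 1) :
    ε (boundary ℤ (nil n) (apexGen A B)) = (-1) ^ ((A : ℕ) - 1) * (A : ℕ) := by
  rw [boundary_apexGen hAB, map_smul, map_sum,
    Finset.sum_congr rfl fun j hj => hε j (Finset.mem_Iio.1 hj)]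
  simp

/-- The homotopy formula in degree `A + 1`, with the multiple of the apex generator determined by
the augmentation. -/
theorem exists_homotopy_succ {o : Fin n} (ho : ∀ i, o ≤ i) (hA : o < A) (hAB : (B : ℕ) = A + 1)
    {ε : ExteriorAlgebra ℤ (nil n) →ₗ[ℤ] ℤ} (hε : ∀ j, j < A → ε (pathGen A B [j]) = 1)
    {a : ExteriorAlgebra ℤ (nil n)} (ha : a ∈ weightSpan n (sinkWeight A B) (A + 1)) :
    ∃ c : ℤ, ε (boundary ℤ (nil n) a) = c * ((-1) ^ ((A : ℕ) - 1) * (A : ℕ)) ∧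
      boundary ℤ (nil n) (prepend A o (a - c • apexGen A B))
        + prepend A o (boundary ℤ (nil n) (a - c • apexGen A B)) = a - c • apexGen A B := by
  have hAB' : A < B := by rw [Fin.lt_def]; omega
  obtain ⟨c, -, hc⟩ := exists_homotopy ho hAB (Nat.lt_succ_self _) ha
  refine ⟨c, ?_, hc⟩
  have hmem : a - c • apexGen A B ∈ weightSpan n (sinkWeight A B) (A + 1) :=
    sub_mem ha (Submodule.smul_mem _ c (apexGen_mem_weightSpan hAB'))
  -- Put `b = a - c • apexGen A B` and write `P` for `prepend A o`. Applying `∂` to the homotopy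
  -- formula gives `∂P∂b = ∂b`, while the bottom-degree formula gives `∂P∂b = ∂b - ε(∂b)[o]`. Hence
  -- `ε(∂b) = 0`.
  have h1 := congrArg (boundary ℤ (nil n)) hc
  rw [map_add, boundary_boundary, zero_add,
    boundary_prepend_self ho hAB hε (boundary_mem_weightSpan _ _ _ hmem), sub_eq_self] at h1
  have h2 := congrArg ε h1
  rw [map_smul, hε o hA, smul_eq_mul, mul_one, map_zero, map_sub, map_sub, map_smul, map_smul,
    augmentation_boundary_apexGen hAB' hε, smul_eq_mul, sub_eq_zero] at h2
  exact h2

/-- A cycle is the boundary of its cone once its apex coefficient vanishes. In degree `A + 1` that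
coefficient times `±A` equals `ε(∂a) = 0`, and `A ≠ 0`. -/
theorem exists_boundary_eq_of_lt {o : Fin n} (ho : ∀ i, o ≤ i) (hA : o < A)
    (hAB : (B : ℕ) = A + 1) {k : ℕ} (hk : (A : ℕ) < k) {a : ExteriorAlgebra ℤ (nil n)}
    (ha : a ∈ weightSpan n (sinkWeight A B) k) (hda : boundary ℤ (nil n) a = 0) :
    ∃ b ∈ weightSpan n (sinkWeight A B) (k + 1), boundary ℤ (nil n) b = a := by
  have hAB' : A < B := by rw [Fin.lt_def]; omega
  have h : boundary ℤ (nil n) (prepend A o a) + prepend A o (boundary ℤ (nil n) a) = a := by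
    by_cases hkA : k = A + 1
    · subst hkA
      obtain ⟨ε, hε⟩ := exists_augmentation hAB'
      obtain ⟨c, hc, h⟩ := exists_homotopy_succ ho hA hAB hε ha
      have hA0 : ((A : ℕ) : ℤ) ≠ 0 := by
        have : (o : ℕ) < A := hA
        omega
      have hc0 : c = 0 := by
        rw [hda, map_zero] at hc
        exact (mul_eq_zero.1 hc.symm).resolve_right
          (mul_ne_zero (pow_ne_zero _ (by norm_num)) hA0)
      simpa [hc0] using h
    · obtain ⟨c, hc, h⟩ := exists_homotopy ho hAB hk ha
      simpa [hc hkA] using h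
  refine ⟨prepend A o a, prepend_mem_weightSpan ho hAB ha, ?_⟩
  rwa [hda, map_zero, add_zero] at h

theorem exists_boundary_eq_of_dvd {o : Fin n} (ho : ∀ i, o ≤ i)
    (hAB : (B : ℕ) = A + 1) {ε : ExteriorAlgebra ℤ (nil n) →ₗ[ℤ] ℤ}
    (hε : ∀ j, j < A → ε (pathGen A B [j]) = 1) {a : ExteriorAlgebra ℤ (nil n)}
    (ha : a ∈ weightSpan n (sinkWeight A B) A) (hdvd : ((A : ℕ) : ℤ) ∣ ε a) :
    ∃ b ∈ weightSpan n (sinkWeight A B) (A + 1), boundary ℤ (nil n) b = a := by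
  have hAB' : A < B := by rw [Fin.lt_def]; omega
  obtain ⟨m, hm⟩ := hdvd
  have hapex := apexGen_mem_weightSpan hAB'
  have hd := boundary_mem_weightSpan _ _ _ hapex
  have h1 := boundary_prepend_self ho hAB hε hd
  rw [augmentation_boundary_apexGen hAB' hε] at h1
  have h2 := boundary_prepend_self ho hAB hε ha
  -- The cone on `a` has boundary `a - ε(a)[o]`, and the apex minus the cone on its boundary has
  -- boundary `±A[o]`. The multiple `t` makes the latter equal to `ε(a)[o]`.
  let t : ℤ := (-1) ^ ((A : ℕ) - 1) * m
  refine ⟨prepend A o a + t • (apexGen A B - prepend A o (boundary ℤ (nil n) (apexGen A B))),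
    add_mem (prepend_mem_weightSpan ho hAB ha) (Submodule.smul_mem _ _
      (sub_mem hapex (prepend_mem_weightSpan ho hAB hd))), ?_⟩
  rw [map_add, h2, map_smul, map_sub, h1, sub_sub_cancel, smul_smul, hm]
  have ht : t * ((-1) ^ ((A : ℕ) - 1) * (A : ℕ)) = (A : ℕ) * m := by
    have : ((-1 : ℤ) ^ ((A : ℕ) - 1)) * (-1) ^ ((A : ℕ) - 1) = 1 := by rw [← mul_pow]; simp
    linear_combination (m * (A : ℕ)) * this
  rw [ht, sub_add_cancel]

end Torsion

/-! ### The homology of the weight complex and the main theorem -/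

theorem bracket_torsionWeight_homology {q n : ℕ} (hq : 0 < q) (hn : q + 2 ≤ n) :
    Nonempty ((bracket (torsionWeight q n)).homology q ≃+ ZMod q) := by
  obtain ⟨m, rfl⟩ : ∃ m, q = m + 1 := ⟨q - 1, by omega⟩
  let A : Fin n := ⟨m + 1, by omega⟩
  let B : Fin n := ⟨m + 2, by omega⟩
  let o : Fin n := ⟨0, by omega⟩
  have ho : ∀ i, o ≤ i := fun i => Nat.zero_le i
  have hA : o < A := Nat.succ_pos m
  have hAB : (B : ℕ) = A + 1 := rfl
  have hAB' : A < B := Nat.lt_succ_self _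
  have hw : unmodify (torsionWeight (m + 1) n) = sinkWeight A B := unmodify_torsionWeight hn
  obtain ⟨ε, hε⟩ := exists_augmentation hAB'
  -- The isomorphism is the augmentation modulo `q`: the cycle `[o]` maps to `1`, and boundaries
  -- have augmentation divisible by `A = q`.
  refine nonempty_complexOf_homology_equiv (boundary_mem_weightSpan _) (k := m)
    ((Int.castAddHom (ZMod (m + 1))).toIntLinearMap ∘ₗ ε) (fun x => ?_) (fun b hb => ?_)
    (fun a ha _ h => ?_)
  · obtain ⟨t, rfl⟩ := ZMod.intCast_surjective x
    have h0 : ∀ w ∈ [o], w < A := by simpa using hA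
    refine ⟨t • pathGen A B [o], ?_, ?_, ?_⟩
    · rw [hw]
      have := pathGen_mem_weightSpan hAB' (List.pairwise_singleton _ o) h0
      rw [List.length_nil, zero_add] at this
      exact Submodule.smul_mem _ t this
    · rw [map_smul, boundary_pathGen_singleton hA hAB', smul_zero]
    · rw [LinearMap.comp_apply, map_smul, hε o hA, smul_eq_mul, mul_one]; rfl
  · rw [hw] at hb
    obtain ⟨c, hc, -⟩ := exists_homotopy_succ ho hA hAB hε hb
    have h0 : (((A : ℕ) : ℤ) : ZMod (m + 1)) = 0 := by
      rw [Int.cast_natCast]; exact ZMod.natCast_self (m + 1)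
    rw [LinearMap.comp_apply, hc]
    change ((c * ((-1) ^ ((A : ℕ) - 1) * ((A : ℕ) : ℤ)) : ℤ) : ZMod (m + 1)) = 0
    rw [Int.cast_mul, Int.cast_mul, h0, mul_zero, mul_zero]
  · rw [hw] at ha ⊢
    exact exists_boundary_eq_of_dvd ho hAB hε ha
      ((ZMod.intCast_zmod_eq_zero_iff_dvd (ε a) (m + 1)).1 h)

theorem bracket_torsionWeight_homology_subsingleton {q n k : ℕ} (hq : 0 < q) (hn : q + 2 ≤ n)
    (hk : k ≠ q) : Subsingleton ((bracket (torsionWeight q n)).homology k) := by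
  let A : Fin n := ⟨q, by omega⟩
  let B : Fin n := ⟨q + 1, by omega⟩
  let o : Fin n := ⟨0, by omega⟩
  have hw : unmodify (torsionWeight q n) = sinkWeight A B := unmodify_torsionWeight hn
  rcases hk.lt_or_gt with hk | hk
  · refine complexOf_homology_subsingleton_of_eq_bot _ ?_
    rw [hw, weightSpan_sinkWeight rfl, generators_eq_empty hk, Submodule.span_empty]
  · obtain ⟨j, rfl⟩ : ∃ j, k = j + 1 := ⟨k - 1, by omega⟩
    refine complexOf_homology_subsingleton _ fun a ha hda => ?_
    rw [hw] at ha ⊢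
    exact exists_boundary_eq_of_lt (o := o) (fun i => Nat.zero_le i) hq rfl hk ha hda

end LieHomology

theorem mainTheorem3 (q n : ℕ) (hq : IsPrimePow q) (hn : q + 2 ≤ n) :
    IsSplitMono (LieHomology.bracketIncl (LieHomology.torsionWeight q n)) ∧
    Nonempty ((LieHomology.bracket (LieHomology.torsionWeight q n)).homology q ≃+ ZMod q) ∧
    (∀ k : ℕ, k ≠ q →
      Subsingleton ((LieHomology.bracket (LieHomology.torsionWeight q n)).homology k)) ∧
    ∃ A : ModuleCat.{0} ℤ, Nonempty
      ((LieHomology.chevalleyEilenberg ℤ (LieHomology.nil n)).homology q ≃+ ZMod q × A) := by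
  have hsplit := LieHomology.isSplitMono_bracketIncl (LieHomology.torsionWeight q n)
  obtain ⟨f⟩ := LieHomology.bracket_torsionWeight_homology hq.pos hn
  refine ⟨hsplit, ⟨f⟩, fun k hk =>
    LieHomology.bracket_torsionWeight_homology_subsingleton hq.pos hn hk, ?_⟩
  -- The homology functor preserves the split monomorphism, so the homology of the subcomplex splits
  -- off.
  obtain ⟨A, ⟨g⟩⟩ := LieHomology.nonempty_equiv_prod_of_isSplitMono
    ((HomologicalComplex.homologyFunctor (ModuleCat.{0} ℤ) _ q).map
      (LieHomology.bracketIncl (LieHomology.torsionWeight q n)))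
  exact ⟨A, ⟨g.trans (f.prodCongr (AddEquiv.refl _))⟩⟩
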